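/- **Setting.** Let $V$ be a finite-dimensional real vector space with scalar product $\langle\cdot,\cdot\rangle$ (extended bilinearly to $V+\mathrm{i}V$), $D\subseteq V$ closed and convex, and $X=(X_t)_{0\le t\le\mathbb T}$ an adapted, time-homogeneous, conservative $D$-valued Markov process with transition kernels $p_t$ on a filtered probability space $(\Omega,\mathcal F,(\mathcal F_t)_{0\le t\le\mathbb T},\mathbb Q)$, with $X_0=x_0$ in the interior of $D$. Put $\mathfrak U_T=\{\zeta\in V+\mathrm iV:\ \mathbb E[|e^{\langle\zeta,X_t\rangle}|]<\infty\ \forall t\in[0,T]\}$. $X$ is *affine* with characteristic exponents $\phi,\psi$: $s\mapsto p_s(x,\cdot)$ is weakly continuous, and $\int_D e^{\langle\zeta,\xi\rangle}p_t(x,d\xi)=e^{\phi(t,\zeta)+\langle\psi(t,\zeta),x\rangle}$ for all $x\in D$, $t\le\mathbb T$, $\zeta\in\mathfrak U_t$. The market consists of OIS zero-coupon bonds with prices $B(t,T)$, $B(T,T)=1$, and, for tenors $0<\delta_1<\dots<\delta_m$, of forward rate agreements (FRAs) with start $T$, maturity $T+\delta_i\le\mathbb T$, rate $K$ and payoff $\delta_i(L_T(T,T+\delta_i)-K)$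 at $T+\delta_i$, whose price is continuous in $K$; $L_t(T,T+\delta_i)$ denotes the rate for which the FRA has price $0$ at $t$. The numéraire $(B_t)$ is strictly positive and adapted with $B_0=1$, and the $B$-discounted prices of all these assets are $\mathbb Q$-martingales up to maturity. Let $S^{\delta_i}(t,T)=(1+\delta_iL_t(T,T+\delta_i))B(t,T+\delta_i)/B(t,T)$. Assume that there are functions $u_k:[0,\mathbb T]\to V$ and $v_k:[0,\mathbb T]\to\mathbb R$, $k=0,\dots,m$, with $u_0(t)\in\mathfrak U_t$ and $u_i(t)+u_0(t)\in\mathfrak U_t$ for $i=1,\dots,m$, such that a.s. $\log B_t=-v_0(t)-\langle u_0(t),X_t\rangle$ for all $t\le\mathbb T$ and $\log S^{\delta_i}(t,t)=v_i(t)+\langle u_i(t),X_t\rangle$ whenever $t+\delta_i\le\mathbb T$ (affine multi-curve model). **Swaption.** Fix $i$, $n\ge1$, dates $T=T_0<T_1<\dots<T_n\le\mathbb T$ with $T_{j+1}-T_j=\delta_i$ for $1\le j\le n-1$, $T+\delta_i\le\mathbb T$, a date $t\in[0,T]$, $N\ge0$ and $K\in\mathbb R$. Let $H=\sum_{j=1}^n\bigl(B(T,T_{j-1})S^{\delta_i}(T,T_{j-1})-(1+\delta_iK)B(T,T_j)\bigr)$,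 let $\Pi^{SWPTN}=N\,B_t\,\mathbb E[H^+/B_T\mid\mathcal F_t]$ be the price of the payer swaption with notional $N$, and for $\beta\in V$, $\alpha\in\mathbb R$ let $$\widetilde\Pi^{SWPTN}(\alpha,\beta)=N\,B_t\,\mathbb E\bigl[(H/B_T)\,\mathbf 1_{\{\langle\beta,X_T\rangle>\alpha\}}\mid\mathcal F_t\bigr].$$ For $j=1,\dots,2n$ put $l=j-1$, $w_j=1$, $u^{(j)}=u_i$, $v^{(j)}=v_i$ if $j\le n$, and $l=j-n$, $w_j=-(1+\delta_iK)$, $u^{(j)}=0$, $v^{(j)}=0$ if $j>n$; and $$c_j=v_0(T_l)+v^{(j)}(T_l)+\phi\bigl(T_l-T,u^{(j)}(T_l)+u_0(T_l)\bigr),\qquad \psi_j=\psi\bigl(T_l-T,u^{(j)}(T_l)+u_0(T_l)\bigr).$$ **Proposition.** Assume $\mathbb Q(\langle\beta,X_T\rangle=\alpha)=0$, $\psi_j\in\mathfrak U_T$ for all $j$, and let $\epsilon\in\mathbb R$ be such that $\psi_j+\epsilon\beta\in\mathfrak U_T$ for all $j=1,\dots,2n$. Then $H/B_T$ is integrable,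 $\widetilde\Pi^{SWPTN}(\alpha,\beta)\le\Pi^{SWPTN}$ a.s., the conditional expectations $\mathbb E[e^{c_j+\langle\psi_j+\mathrm i\beta\zeta,X_T\rangle}\mid\mathcal F_t]$ have versions that are jointly measurable in $\omega$ and $\zeta\in(0,\infty)-\mathrm i\epsilon$, and, for any such versions, a.s. $$\widetilde\Pi^{SWPTN}(\alpha,\beta)=NB_t\sum_{j=1}^{2n}w_j\Bigl(R_{\epsilon,j}+\frac1\pi\int_{0-\mathrm i\epsilon}^{\infty-\mathrm i\epsilon}\Re\Bigl(\frac{e^{-\mathrm i\zeta\alpha}}{\mathrm i\zeta}\,\mathbb E\bigl[e^{c_j+\langle\psi_j+\mathrm i\beta\zeta,X_T\rangle}\mid\mathcal F_t\bigr]\Bigr)d\zeta\Bigr),$$ where the integrals converge as improper integrals $\lim_{r\downarrow0,\,R\uparrow\infty}\int_{r-\mathrm i\epsilon}^{R-\mathrm i\epsilon}$, and $R_{\epsilon,j}=\mathbb E[e^{c_j+\langle\psi_j,X_T\rangle}\mid\mathcal F_t]$ if $\epsilon<0$, $R_{\epsilon,j}=\tfrac12\mathbb E[e^{c_j+\langle\psi_j,X_T\rangle}\mid\mathcal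 F_t]$ if $\epsilon=0$, and $R_{\epsilon,j}=0$ if $\epsilon>0$. -/

import Mathlib

open MeasureTheory ProbabilityTheory Filter Topology
open scoped NNReal BoundedContinuousFunction

namespace MultiCurve

/-! ### The complexification `V + iV` -/

section Complexification

variable {V : Type*} [NormedAddCommGroup V] [InnerProductSpace ℝ V]

/-- The bilinear pairing `⟨ζ, x⟩ = ⟨Re ζ, x⟩ + i ⟨Im ζ, x⟩` of `ζ ∈ V + iV` with `x ∈ V`.
An element `a + i b` of `V + iV` is represented by the pair `(a, b)`. -/
noncomputable def cpair (ζ : V × V) (x : V) : ℂ :=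
  ((inner ℝ ζ.1 x : ℝ) : ℂ) + Complex.I * ((inner ℝ ζ.2 x : ℝ) : ℂ)

/-- The product `z b ∈ V + iV` of a complex number `z` and a vector `b ∈ V`. -/
def cmul (z : ℂ) (b : V) : V × V := (z.re • b, z.im • b)

end Complexification

/-! ### Affine processes -/

section Affine

variable {Ω : Type*} [mΩ : MeasurableSpace Ω]
  {V : Type*} [NormedAddCommGroup V] [InnerProductSpace ℝ V] [MeasurableSpace V]

/-- The set `𝔘_T` of all `ζ ∈ V + iV` with `𝔼[exp ⟨ζ, X_t⟩]` finite for all `t ∈ [0, T]`. -/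
def expMomentSet (μ : Measure Ω) {D : Set V} (X : ℝ≥0 → Ω → D) (T : ℝ≥0) : Set (V × V) :=
  {ζ | ∀ t ≤ T, Integrable (fun ω => Complex.exp (cpair ζ (X t ω : V))) μ}

/-- `X` is, on the time interval `[0, 𝕋]`, an adapted time-homogeneous conservative Markov process
with values in the closed convex set `D`, with transition kernels `p`, and started at an interior
point of `D`. -/
structure IsMarkovProcess (μ : Measure Ω) (ℱ : Filtration ℝ≥0 mΩ) (𝕋 : ℝ≥0) (D : Set V)
    (p : ℝ≥0 → Kernel D D) (X : ℝ≥0 → Ω → D) : Prop where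
  isClosed : IsClosed D
  convex : Convex ℝ D
  adapted : ∀ t ≤ 𝕋, Measurable[ℱ t] (X t)
  initial : ∃ x : D, (x : V) ∈ interior D ∧ ∀ᵐ ω ∂μ, X 0 ω = x
  conservative : ∀ t ≤ 𝕋, IsMarkovKernel (p t)
  kernel_zero : ∀ x, p 0 x = Measure.dirac x
  chapman_kolmogorov : ∀ s t, s + t ≤ 𝕋 → ∀ (x : D) (A : Set D), MeasurableSet A →
    p (s + t) x A = ∫⁻ y, p t y A ∂(p s x)
  markov : ∀ s t, s ≤ t → t ≤ 𝕋 → ∀ A : Set D, MeasurableSet A →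
    μ[(X t ⁻¹' A).indicator (fun _ => (1 : ℝ)) | ℱ s] =ᵐ[μ] fun ω => (p (t - s) (X s ω)).real A

/-- `X` is an affine process on `[0, 𝕋]` with characteristic exponents `φ` and `ψ`. -/
structure IsAffineProcess (μ : Measure Ω) (ℱ : Filtration ℝ≥0 mΩ) (𝕋 : ℝ≥0) (D : Set V)
    (p : ℝ≥0 → Kernel D D) (X : ℝ≥0 → Ω → D)
    (φ : ℝ≥0 → V × V → ℂ) (ψ : ℝ≥0 → V × V → V × V) : Prop
    extends IsMarkovProcess μ ℱ 𝕋 D p X where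
  stochasticallyContinuous : ∀ t ≤ 𝕋, ∀ (x : D) (f : D →ᵇ ℝ),
    Tendsto (fun s => ∫ y, f y ∂(p s x)) (𝓝[Set.Iic 𝕋] t) (𝓝 (∫ y, f y ∂(p t x)))
  affine : ∀ t ≤ 𝕋, ∀ ζ ∈ expMomentSet μ X t, ∀ x : D,
    Integrable (fun ξ : D => Complex.exp (cpair ζ (ξ : V))) (p t x) ∧
    ∫ ξ : D, Complex.exp (cpair ζ (ξ : V)) ∂(p t x)
      = Complex.exp (φ t ζ + cpair (ψ t ζ) (x : V))

end Affine

/-! ### The multi-curve market -/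

/-- The processes describing a multi-curve market with `m` tenors:
`numeraire t` is `B_t`; `bond t T` is the price `B(t, T)` at `t` of the OIS zero-coupon bond with
maturity `T`; `tenor i` is `δ_i`; `fra i t T K` is the price at `t` of the forward rate agreement
starting at `T` with maturity `T + δ_i`, rate `K` and unit notional; `fraRate i t T` is
the fair rate `L_t(T, T + δ_i)` (the Xibor rate if `t = T`). -/
structure Market (Ω : Type*) (m : ℕ) where
  numeraire : ℝ≥0 → Ω → ℝ
  bond : ℝ≥0 → ℝ≥0 → Ω → ℝ
  tenor : Fin m → ℝ≥0
  fra : Fin m → ℝ≥0 → ℝ≥0 → ℝ → Ω → ℝ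
  fraRate : Fin m → ℝ≥0 → ℝ≥0 → Ω → ℝ

namespace Market

variable {Ω : Type*} [mΩ : MeasurableSpace Ω] {m : ℕ}

/-- The multiplicative spread
`S^{δ_i}(t, T) = (1 + δ_i L_t(T, T + δ_i)) B(t, T + δ_i) / B(t, T)`. -/
noncomputable def spread (M : Market Ω m) (i : Fin m) (t T : ℝ≥0) (ω : Ω) : ℝ :=
  (1 + (M.tenor i : ℝ) * M.fraRate i t T ω) * M.bond t (T + M.tenor i) ω / M.bond t T ω

/-- The contractual specification of the basic traded assets up to the horizon `𝕋`: bonds pay `1`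
at maturity, a forward rate agreement pays `δ_i (L_T(T, T + δ_i) - K)` at `T + δ_i`, and
`L_t(T, T + δ_i)` is the rate for which its price at `t` vanishes. (Continuity of the price in the
rate makes the price at a random rate independent of the versions chosen for each rate.) -/
structure IsContractual (M : Market Ω m) (μ : Measure Ω) (𝕋 : ℝ≥0) : Prop where
  tenor_pos : ∀ i, 0 < M.tenor i
  tenor_strictMono : StrictMono M.tenor
  bond_maturity : ∀ T ≤ 𝕋, ∀ᵐ ω ∂μ, M.bond T T ω = 1
  fra_payoff : ∀ i T K, T + M.tenor i ≤ 𝕋 → ∀ᵐ ω ∂μ,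
    M.fra i (T + M.tenor i) T K ω = (M.tenor i : ℝ) * (M.fraRate i T T ω - K)
  fra_continuous : ∀ i t T, t ≤ T → T + M.tenor i ≤ 𝕋 → ∀ᵐ ω ∂μ,
    Continuous fun K => M.fra i t T K ω
  fra_fair : ∀ i t T, t ≤ T → T + M.tenor i ≤ 𝕋 → ∀ᵐ ω ∂μ,
    M.fra i t T (M.fraRate i t T ω) ω = 0

/-- `(B, μ)` is a numéraire - martingale measure couple: `B` is strictly positive and adapted with
`B_0 = 1`, and the `B`-discounted price of every basic traded asset is a `μ`-martingale up to its
maturity. -/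
structure IsNumeraireMartingaleCouple (M : Market Ω m) (μ : Measure Ω) (ℱ : Filtration ℝ≥0 mΩ)
    (𝕋 : ℝ≥0) : Prop where
  numeraire_pos : ∀ t ≤ 𝕋, ∀ ω, 0 < M.numeraire t ω
  numeraire_adapted : ∀ t ≤ 𝕋, Measurable[ℱ t] (M.numeraire t)
  numeraire_zero : ∀ ω, M.numeraire 0 ω = 1
  bond_martingale : ∀ T ≤ 𝕋,
    Martingale (fun t ω => M.bond (min t T) T ω / M.numeraire (min t T) ω) ℱ μ
  fra_martingale : ∀ i T K, T + M.tenor i ≤ 𝕋 →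
    Martingale (fun t ω => M.fra i (min t (T + M.tenor i)) T K ω
      / M.numeraire (min t (T + M.tenor i)) ω) ℱ μ

/-- The price at `t` of a claim with payoff `H` at `T`: `B_t 𝔼[H / B_T | ℱ_t]`, which is
`𝔼[(B_t / B_T) H | ℱ_t]` since `B_t` is `ℱ_t`-measurable. -/
noncomputable def claimPrice (M : Market Ω m) (μ : Measure Ω) (ℱ : Filtration ℝ≥0 mΩ)
    (t T : ℝ≥0) (H : Ω → ℝ) (ω : Ω) : ℝ :=
  M.numeraire t ω * (μ[fun ω' => H ω' / M.numeraire T ω' | ℱ t]) ω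

/-- The value at `T_0` of the payer swap with unit notional, fixed rate `K`, start `T_0` and payment
dates `T_1, …, T_n`:
`∑_{j=1}^n (B(T_0, T_{j-1}) S^{δ_i}(T_0, T_{j-1}) - (1 + δ_i K) B(T_0, T_j))`. -/
noncomputable def swapValue (M : Market Ω m) (i : Fin m) (n : ℕ) (Ts : ℕ → ℝ≥0) (K : ℝ)
    (ω : Ω) : ℝ :=
  ∑ j ∈ Finset.Icc 1 n,
    (M.bond (Ts 0) (Ts (j - 1)) ω * M.spread i (Ts 0) (Ts (j - 1)) ω
      - (1 + (M.tenor i : ℝ) * K) * M.bond (Ts 0) (Ts j) ω)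

/-- The price at `t` of the payer swaption with notional `N` and maturity `T_0`. -/
noncomputable def swaptionPrice (M : Market Ω m) (μ : Measure Ω) (ℱ : Filtration ℝ≥0 mΩ)
    (t : ℝ≥0) (i : Fin m) (n : ℕ) (Ts : ℕ → ℝ≥0) (N K : ℝ) (ω : Ω) : ℝ :=
  N * M.claimPrice μ ℱ t (Ts 0) (fun ω' => max (M.swapValue i n Ts K ω') 0) ω

/-- The quantity `Π̃(α, β)`: the price at `t` of the swap value at `T_0`, restricted to the
event `G` (the exercise event being replaced by `G`). -/
noncomputable def swaptionLowerBound (M : Market Ω m) (μ : Measure Ω) (ℱ : Filtration ℝ≥0 mΩ)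
    (t : ℝ≥0) (i : Fin m) (n : ℕ) (Ts : ℕ → ℝ≥0) (N K : ℝ) (G : Set Ω) (ω : Ω) : ℝ :=
  N * M.claimPrice μ ℱ t (Ts 0) (G.indicator (M.swapValue i n Ts K)) ω

end Market

/-! ### Affine multi-curve models -/

section Model

variable {Ω : Type*} [mΩ : MeasurableSpace Ω]
  {V : Type*} [NormedAddCommGroup V] [InnerProductSpace ℝ V] [MeasurableSpace V] {m : ℕ}

/-- `(X, u, v)` is an affine multi-curve model for the market `M`; the index `0` of `u` and `v`
refers to the numéraire, the index `i.succ` to the tenor `δ_i`. The equations for `log B_t` and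
`log S^{δ_i}(t, t)` are written in exponential form. -/
structure IsAffineMultiCurveModel (M : Market Ω m) (μ : Measure Ω) (𝕋 : ℝ≥0) {D : Set V}
    (X : ℝ≥0 → Ω → D) (u : Fin (m + 1) → ℝ≥0 → V) (v : Fin (m + 1) → ℝ≥0 → ℝ) : Prop where
  u_zero_mem : ∀ t ≤ 𝕋, ((u 0 t, 0) : V × V) ∈ expMomentSet μ X t
  u_succ_mem : ∀ (i : Fin m), ∀ t ≤ 𝕋, ((u i.succ t + u 0 t, 0) : V × V) ∈ expMomentSet μ X t
  numeraire_eq : ∀ t ≤ 𝕋, ∀ᵐ ω ∂μ,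
    M.numeraire t ω = Real.exp (-v 0 t - inner ℝ (u 0 t) (X t ω : V))
  spread_eq : ∀ (i : Fin m) (t : ℝ≥0), t + M.tenor i ≤ 𝕋 → ∀ᵐ ω ∂μ,
    M.spread i t t ω = Real.exp (v i.succ t + inner ℝ (u i.succ t) (X t ω : V))

end Model

/-! ### The ingredients of the swaption formula -/

section Swaption

variable {V : Type*} {m : ℕ}

/-- The date index `l`: `j - 1` for `1 ≤ j ≤ n` and `j - n` for `n < j ≤ 2n`. -/
def dateIndex (n j : ℕ) : ℕ := if j ≤ n then j - 1 else j - n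

/-- The weight `w_{i,j}`: `1` for `j ≤ n` and `-(1 + δ_i K)` for `n < j`. -/
noncomputable def weight (δ K : ℝ) (n j : ℕ) : ℝ := if j ≤ n then 1 else -(1 + δ * K)

/-- `u_{i,j}`: equal to `u_i` for `j ≤ n` and to `0` for `n < j` (likewise `v_{i,j}`). -/
def legFun {W : Type*} [Zero W] (u : Fin (m + 1) → ℝ≥0 → W) (i : Fin m) (n j : ℕ) (s : ℝ≥0) : W :=
  if j ≤ n then u i.succ s else 0

/-- The argument `u_{i,j}(T_l) + u_0(T_l)`, as an element of `V + iV`. -/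
def legArg [AddCommGroup V] (u : Fin (m + 1) → ℝ≥0 → V) (i : Fin m) (n : ℕ) (Ts : ℕ → ℝ≥0)
    (j : ℕ) : V × V :=
  (legFun u i n j (Ts (dateIndex n j)) + u 0 (Ts (dateIndex n j)), 0)

/-- `v_0(T_l) + v_{i,j}(T_l) + φ(T_l - T_0, u_{i,j}(T_l) + u_0(T_l))`. -/
noncomputable def legConst [AddCommGroup V] (φ : ℝ≥0 → V × V → ℂ) (u : Fin (m + 1) → ℝ≥0 → V)
    (v : Fin (m + 1) → ℝ≥0 → ℝ) (i : Fin m) (n : ℕ) (Ts : ℕ → ℝ≥0) (j : ℕ) : ℂ :=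
  ((v 0 (Ts (dateIndex n j)) + legFun v i n j (Ts (dateIndex n j)) : ℝ) : ℂ)
    + φ (Ts (dateIndex n j) - Ts 0) (legArg u i n Ts j)

/-- `ψ(T_l - T_0, u_{i,j}(T_l) + u_0(T_l))`. -/
noncomputable def legDir [AddCommGroup V] (ψ : ℝ≥0 → V × V → V × V) (u : Fin (m + 1) → ℝ≥0 → V)
    (i : Fin m) (n : ℕ) (Ts : ℕ → ℝ≥0) (j : ℕ) : V × V :=
  ψ (Ts (dateIndex n j) - Ts 0) (legArg u i n Ts j)

/-- The point `x - i ε` of the contour from `0 - i ε` to `∞ - i ε`. -/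
noncomputable def contourPoint (ε x : ℝ) : ℂ := (x : ℂ) - Complex.I * (ε : ℂ)

/-- `I` is the improper Riemann integral `∫_0^∞ f(x) dx`, improper at both ends:
the limit of `∫_r^R f(x) dx` as `r ↓ 0` and `R ↑ ∞`. -/
def HasImproperIntegral (f : ℝ → ℝ) (I : ℝ) : Prop :=
  (∀ r R : ℝ, 0 < r → r ≤ R → IntervalIntegrable f volume r R) ∧
  Tendsto (fun q : ℝ × ℝ => ∫ x in q.1..q.2, f x) (𝓝[>] (0 : ℝ) ×ˢ atTop) (𝓝 I)

variable {Ω : Type*} [mΩ : MeasurableSpace Ω] [NormedAddCommGroup V] [InnerProductSpace ℝ V]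

/-- `𝔼[exp (c + ⟨b, Y⟩) | ℱ_t]` for `c ∈ ℂ`, `b ∈ V + iV` and a random vector `Y` of `V`. -/
noncomputable def condTransform (μ : Measure Ω) (ℱ : Filtration ℝ≥0 mΩ) (t : ℝ≥0) (Y : Ω → V)
    (c : ℂ) (b : V × V) : Ω → ℂ :=
  μ[fun ω => Complex.exp (c + cpair b (Y ω)) | ℱ t]

/-- `Φ` is a jointly measurable version, along the contour `ζ = x - i ε`, `x > 0`, of the conditional
transform `𝔼[exp (c + ⟨b + i β ζ, Y⟩) | ℱ_t]`. -/
def IsTransformVersion (μ : Measure Ω) (ℱ : Filtration ℝ≥0 mΩ) (t : ℝ≥0) (Y : Ω → V)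
    (c : ℂ) (b : V × V) (β : V) (ε : ℝ) (Φ : ℝ → Ω → ℂ) : Prop :=
  Measurable (Function.uncurry Φ) ∧
  ∀ x : ℝ, 0 < x →
    Φ x =ᵐ[μ] condTransform μ ℱ t Y c (b + cmul (Complex.I * contourPoint ε x) β)

/-- The residue term `R_ε`. -/
noncomputable def residue (μ : Measure Ω) (ℱ : Filtration ℝ≥0 mΩ) (t : ℝ≥0) (Y : Ω → V)
    (c : ℂ) (b : V × V) (ε : ℝ) (ω : Ω) : ℂ :=
  if ε < 0 then condTransform μ ℱ t Y c b ω
  else if ε = 0 then 1 / 2 * condTransform μ ℱ t Y c b ω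
  else 0

/-- The Fourier integrand `Re (e^{-iζα} / (iζ) * F)` at `ζ = x - i ε`. -/
noncomputable def fourierIntegrand (α ε : ℝ) (F : ℝ → ℂ) (x : ℝ) : ℝ :=
  (Complex.exp (-Complex.I * contourPoint ε x * (α : ℂ)) / (Complex.I * contourPoint ε x)
    * F x).re

end Swaption

end MultiCurve

open MultiCurve

/-! The discounted swap value is almost surely a finite sum of exponentials of `X_T`. For a bond,
the martingale property gives `B(T,S)/B_T = E[1/B_S | F_T]`, and `1/B_S` is exponential affine in
`X_S`. For a floating leg, the FRA martingales identify `(1 + δ L_T) B(T,S+δ)/B_T` with the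
conditional expectation of the same quantity at the fixing date `S`, where it equals `S(S,S)/B_S`,
again exponential affine. The affine transform formula then yields `e^{c_j + ⟨ψ_j, X_T⟩}` for each
leg (`swapValue_div_numeraire_ae_eq`).

By the Markov property (`IsMarkovProcess.condExp_comp`), every conditional expectation in the
formula is, for almost every `ω`, an integral against one probability measure `ν`, the transition
law from `X_t(ω)`. What remains is deterministic: with `y` the exponential of a leg and `z = ⟨β,
·⟩`, recover the `y dν`-mass of `{z > α}` from Fourier data on the line `Im ζ = -ε`.

No contour is shifted. At `ζ = x - iε` the kernel `Re(e^{iζ(z-α)}/(iζ))` has an explicit primitive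
in `x`, built from arctan and the sine integral. This primitive tends to `0` at `0` and to `(sgn ε +
sgn(z-α)) π/2` at infinity, and it is bounded by a multiple of `1 + e^{ε(z-α)}` uniformly in `x`.
Hence Fubini on `[r, R]` and dominated convergence evaluate the improper integral
(`hasImproperIntegral_fourierIntegrand`). The residue is `(1 - sgn ε)/2 ∫ y dν`, and the sum has
density `(1 + sgn(z-α))/2`, the indicator of `{z > α}` off the null set `{z = α}`
(`integral_indicator_eq_residue_add`).

The lower bound is monotonicity of conditional expectation applied to `H 1_G ≤ H⁺`. -/

namespace MultiCurve

/-! ### The sine integral -/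

/-- The sine integral `∫_0^y sin x / x dx`. -/
noncomputable def sineIntegral (y : ℝ) : ℝ := ∫ x in (0 : ℝ)..y, Real.sinc x

lemma hasDerivAt_sineIntegral (y : ℝ) : HasDerivAt sineIntegral (Real.sinc y) y :=
  intervalIntegral.integral_hasDerivAt_right (Real.continuous_sinc.intervalIntegrable _ _)
    Real.continuous_sinc.stronglyMeasurable.stronglyMeasurableAtFilter
    Real.continuous_sinc.continuousAt

@[fun_prop]
lemma continuous_sineIntegral : Continuous sineIntegral :=
  continuous_iff_continuousAt.2 fun y => (hasDerivAt_sineIntegral y).continuousAt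

@[simp]
lemma sineIntegral_zero : sineIntegral 0 = 0 := by simp [sineIntegral]

lemma sineIntegral_neg (y : ℝ) : sineIntegral (-y) = -sineIntegral y := by
  have h := intervalIntegral.integral_comp_neg (a := 0) (b := y) Real.sinc
  simp only [Real.sinc_neg, neg_zero] at h
  rw [sineIntegral, sineIntegral, h, intervalIntegral.integral_symm]

lemma integrableOn_exp_neg_mul_Ioi {x : ℝ} (hx : 0 < x) :
    IntegrableOn (fun y => Real.exp (-(x * y))) (Set.Ioi 0) := by
  simpa using integrableOn_exp_mul_Ioi (neg_lt_zero.2 hx) 0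

lemma integral_exp_neg_mul_Ioi {x : ℝ} (hx : 0 < x) :
    ∫ y in Set.Ioi (0 : ℝ), Real.exp (-(x * y)) = x⁻¹ := by
  have := integral_exp_mul_Ioi (neg_lt_zero.2 hx) 0
  simp only [neg_mul, mul_zero, Real.exp_zero] at this
  rw [this]; simp

/-- Integrating the absolute value over `y` first leaves `|sin x|/x ≤ 1` on a bounded interval. This
licenses Fubini in the evaluation of the sine integral. -/
lemma integrable_exp_neg_mul_sin_prod (R : ℝ) :
    Integrable (fun q : ℝ × ℝ => Real.exp (-(q.1 * q.2)) * Real.sin q.1)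
      ((volume.restrict (Set.Ioc 0 R)).prod (volume.restrict (Set.Ioi (0 : ℝ)))) := by
  have hm : Measurable (fun q : ℝ × ℝ => Real.exp (-(q.1 * q.2)) * Real.sin q.1) := by fun_prop
  refine (integrable_prod_iff hm.aestronglyMeasurable).2 ⟨?_, ?_⟩
  · refine (ae_restrict_iff' measurableSet_Ioc).2 (ae_of_all _ fun x hx => ?_)
    exact Integrable.mul_const (integrableOn_exp_neg_mul_Ioi hx.1) (Real.sin x)
  · refine Integrable.mono' (g := fun _ => (1 : ℝ)) (integrable_const _)
      (hm.norm.stronglyMeasurable.integral_prod_right'.aestronglyMeasurable) ?_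
    refine (ae_restrict_iff' measurableSet_Ioc).2 (ae_of_all _ fun x hx => ?_)
    simp only [norm_mul, Real.norm_eq_abs, Real.abs_exp]
    rw [integral_mul_const, integral_exp_neg_mul_Ioi hx.1, abs_mul, abs_abs, abs_inv,
      abs_of_pos hx.1]
    rw [inv_mul_le_iff₀ hx.1, mul_one]
    simpa [abs_of_pos hx.1] using Real.abs_sin_le_abs (x := x)

lemma integral_exp_neg_mul_sin (R y : ℝ) :
    ∫ x in (0 : ℝ)..R, Real.exp (-(x * y)) * Real.sin x
      = (1 + y ^ 2)⁻¹ - Real.exp (-(R * y)) * (Real.cos R + y * Real.sin R) * (1 + y ^ 2)⁻¹ := by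
  have h1 : (1 + y ^ 2) ≠ 0 := by positivity
  rw [intervalIntegral.integral_eq_sub_of_hasDerivAt
    (f := fun x => -(Real.exp (-(x * y)) * (Real.cos x + y * Real.sin x) * (1 + y ^ 2)⁻¹))]
  · simp; ring
  · intro x _
    have e : HasDerivAt (fun x : ℝ => Real.exp (-(x * y))) (Real.exp (-(x * y)) * (-y)) x := by
      simpa using ((hasDerivAt_id x).mul_const y).neg.exp
    have := ((e.mul ((Real.hasDerivAt_cos x).add ((Real.hasDerivAt_sin x).const_mul y))).mul_const
      (1 + y ^ 2)⁻¹).neg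
    convert! this using 1
    simp only [Pi.add_apply]
    field_simp
    ring
  · exact Continuous.intervalIntegrable (by fun_prop) _ _

/-- Write `1/x = ∫_0^∞ e^{-xy} dy` and exchange the integrals. The inner integral is elementary: its
main term `1/(1+y²)` integrates to `π/2`, and the remainder is at most `2e^{-Ry}`, whose integral is
`2/R`. -/
lemma abs_sineIntegral_sub_le {R : ℝ} (hR : 0 < R) :
    |sineIntegral R - Real.pi / 2| ≤ 2 / R := by
  have hprod := integrable_exp_neg_mul_sin_prod R
  have h1 : sineIntegral R = ∫ y in Set.Ioi (0 : ℝ),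
      ((1 + y ^ 2)⁻¹ - Real.exp (-(R * y)) * (Real.cos R + y * Real.sin R) * (1 + y ^ 2)⁻¹) := by
    calc sineIntegral R = ∫ x in Set.Ioc 0 R, ∫ y in Set.Ioi (0 : ℝ),
          Real.exp (-(x * y)) * Real.sin x := by
          rw [sineIntegral, intervalIntegral.integral_of_le hR.le]
          refine setIntegral_congr_fun measurableSet_Ioc fun x hx => ?_
          rw [integral_mul_const, integral_exp_neg_mul_Ioi hx.1, Real.sinc_of_ne_zero hx.1.ne']
          ring
      _ = ∫ y in Set.Ioi (0 : ℝ), ∫ x in Set.Ioc 0 R, Real.exp (-(x * y)) * Real.sin x :=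
          integral_integral_swap hprod
      _ = _ := by
          refine setIntegral_congr_fun measurableSet_Ioi fun y _ => ?_
          rw [← intervalIntegral.integral_of_le hR.le, integral_exp_neg_mul_sin]
  have hb : ∀ y ∈ Set.Ioi (0 : ℝ),
      ‖Real.exp (-(R * y)) * (Real.cos R + y * Real.sin R) * (1 + y ^ 2)⁻¹‖
        ≤ 2 * Real.exp (-(R * y)) := by
    intro y hy
    have hy : 0 < y := hy
    have hp : 0 < 1 + y ^ 2 := by positivity
    have h2 : |Real.cos R + y * Real.sin R| ≤ 2 * (1 + y ^ 2) := by
      calc |Real.cos R + y * Real.sin R| ≤ |Real.cos R| + |y * Real.sin R| := abs_add_le _ _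
        _ ≤ 1 + y * 1 := by
          rw [abs_mul, abs_of_pos hy]
          gcongr
          · exact Real.abs_cos_le_one R
          · exact Real.abs_sin_le_one R
        _ ≤ 2 * (1 + y ^ 2) := by nlinarith [sq_nonneg (y - 1)]
    rw [norm_mul, norm_mul, Real.norm_eq_abs, Real.norm_eq_abs, Real.norm_eq_abs, Real.abs_exp,
      abs_inv, abs_of_pos hp, mul_assoc, mul_comm (2 : ℝ)]
    gcongr
    rwa [← div_eq_mul_inv, div_le_iff₀ hp]
  have hgi : IntegrableOn (fun y => 2 * Real.exp (-(R * y))) (Set.Ioi 0) :=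
    (integrableOn_exp_neg_mul_Ioi hR).const_mul 2
  have hi : IntegrableOn (fun y => Real.exp (-(R * y)) * (Real.cos R + y * Real.sin R)
      * (1 + y ^ 2)⁻¹) (Set.Ioi 0) :=
    Integrable.mono' hgi (by fun_prop) ((ae_restrict_iff' measurableSet_Ioi).2 (ae_of_all _ hb))
  rw [h1, integral_sub integrable_inv_one_add_sq.integrableOn hi, integral_Ioi_inv_one_add_sq,
    Real.arctan_zero, sub_zero, sub_sub_cancel_left, abs_neg, ← Real.norm_eq_abs]
  refine (norm_integral_le_of_norm_le hgi
    ((ae_restrict_iff' measurableSet_Ioi).2 (ae_of_all _ hb))).trans ?_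
  rw [integral_const_mul, integral_exp_neg_mul_Ioi hR, div_eq_mul_inv]

lemma tendsto_sineIntegral_atTop : Tendsto sineIntegral atTop (𝓝 (Real.pi / 2)) := by
  rw [tendsto_iff_norm_sub_tendsto_zero]
  refine squeeze_zero' (Eventually.of_forall fun _ => norm_nonneg _)
    ((eventually_gt_atTop 0).mono fun R hR => abs_sineIntegral_sub_le hR) ?_
  exact tendsto_const_nhds.div_atTop tendsto_id

/-- By oddness take `y ≥ 0`; below `1` use `|sinc| ≤ 1`, above `1` the rate `2/y ≤ 2`. Only
uniformity in `y` matters: the bound feeds dominated convergence. -/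
lemma abs_sineIntegral_le (y : ℝ) : |sineIntegral y| ≤ Real.pi / 2 + 2 := by
  have hpi := Real.pi_pos
  wlog hy : 0 ≤ y generalizing y
  · have := this (-y) (by linarith)
    rwa [sineIntegral_neg, abs_neg] at this
  rcases le_total y 1 with h | h
  · have : ‖sineIntegral y‖ ≤ 1 * |y - 0| :=
      intervalIntegral.norm_integral_le_of_norm_le_const fun x _ => Real.abs_sinc_le_one x
    rw [Real.norm_eq_abs, sub_zero, one_mul, abs_of_nonneg hy] at this
    linarith
  · have h1 := abs_sineIntegral_sub_le (by linarith : 0 < y)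
    have h2 : 2 / y ≤ 2 := by rw [div_le_iff₀ (by linarith)]; linarith
    have h3 := abs_le.1 (h1.trans h2)
    exact abs_le.2 ⟨by linarith [h3.1], by linarith [h3.2]⟩

lemma tendsto_sineIntegral_mul_atTop (s : ℝ) :
    Tendsto (fun x => sineIntegral (x * s)) atTop (𝓝 (SignType.sign s * (Real.pi / 2))) := by
  rcases lt_trichotomy s 0 with h | rfl | h
  · have : Tendsto (fun x => -sineIntegral (x * (-s))) atTop (𝓝 (-(Real.pi / 2))) :=
      (tendsto_sineIntegral_atTop.comp (tendsto_id.atTop_mul_const (neg_pos.2 h))).neg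
    simpa [sign_neg h, sineIntegral_neg] using this
  · simp
  · simpa [sign_pos h, Function.comp_def] using
      tendsto_sineIntegral_atTop.comp (tendsto_id.atTop_mul_const h)

end MultiCurve

namespace MultiCurve

/-! ### A primitive of the damped Fourier kernel -/

/-- The damped Fourier kernel `Re (e^{(ix+ε)s} / (ix+ε))`. -/
noncomputable def dampedKernel (ε s x : ℝ) : ℝ :=
  Real.exp (ε * s) * ((x * Real.sin (x * s) + ε * Real.cos (x * s)) / (ε ^ 2 + x ^ 2))

/-- The integral `∫_0^s ε e^{εσ} Si(xσ) dσ`. -/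
noncomputable def sineIntegralAverage (ε s x : ℝ) : ℝ :=
  ∫ σ in (0 : ℝ)..s, ε * Real.exp (ε * σ) * sineIntegral (x * σ)

/-- A primitive on `(0, ∞)` of the damped Fourier kernel in the variable `x`. -/
noncomputable def dampedPrimitive (ε s x : ℝ) : ℝ :=
  Real.arctan (x / ε) + Real.exp (ε * s) * sineIntegral (x * s) - sineIntegralAverage ε s x

lemma hasDerivAt_exp_mul (ε σ : ℝ) :
    HasDerivAt (fun σ : ℝ => Real.exp (ε * σ)) (ε * Real.exp (ε * σ)) σ := by
  have := ((hasDerivAt_id σ).const_mul ε).exp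
  simpa [mul_comm] using this

lemma integral_mul_exp_mul (ε s : ℝ) :
    ∫ σ in (0 : ℝ)..s, ε * Real.exp (ε * σ) = Real.exp (ε * s) - 1 := by
  rw [intervalIntegral.integral_eq_sub_of_hasDerivAt (fun σ _ => hasDerivAt_exp_mul ε σ)
    (Continuous.intervalIntegrable (by fun_prop) _ _)]
  simp

lemma hasDerivAt_arctan_div (ε : ℝ) {x : ℝ} (hx : 0 < x) :
    HasDerivAt (fun x => Real.arctan (x / ε)) (ε / (ε ^ 2 + x ^ 2)) x := by
  rcases eq_or_ne ε 0 with rfl | h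
  · simpa using hasDerivAt_const x (0 : ℝ)
  · have := ((hasDerivAt_id x).div_const ε).arctan
    convert! this using 1
    have : ε ^ 2 + x ^ 2 ≠ 0 := by positivity
    have : 1 + (x / ε) ^ 2 ≠ 0 := by positivity
    simp only [id]
    field_simp

/-- The factor `sinc(xσ) σ` is the derivative of `Si(xσ)` in `x`, so this evaluates the derivative
of `sineIntegralAverage`. -/
lemma integral_exp_mul_sinc (ε s : ℝ) {x : ℝ} (hx : 0 < x) :
    ∫ σ in (0 : ℝ)..s, ε * Real.exp (ε * σ) * (Real.sinc (x * σ) * σ)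
      = ε / (x * (ε ^ 2 + x ^ 2))
        * (Real.exp (ε * s) * (ε * Real.sin (x * s) - x * Real.cos (x * s)) + x) := by
  have h0 : ε ^ 2 + x ^ 2 ≠ 0 := by positivity
  have hs : ∀ σ, Real.sinc (x * σ) * σ = Real.sin (x * σ) / x := by
    intro σ
    rcases eq_or_ne σ 0 with rfl | h
    · simp
    · rw [Real.sinc_of_ne_zero (by positivity)]
      field_simp
  simp only [hs]
  rw [intervalIntegral.integral_eq_sub_of_hasDerivAt
    (f := fun σ => ε / (x * (ε ^ 2 + x ^ 2))
        * (Real.exp (ε * σ) * (ε * Real.sin (x * σ) - x * Real.cos (x * σ))))]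
  · simp; ring
  · intro σ _
    have hl : HasDerivAt (fun σ : ℝ => x * σ) x σ := by
      simpa using (hasDerivAt_id σ).const_mul x
    have := (((hasDerivAt_exp_mul ε σ).mul
      ((hl.sin.const_mul ε).sub (hl.cos.const_mul x))).const_mul (ε / (x * (ε ^ 2 + x ^ 2))))
    convert! this using 1
    simp only [Pi.sub_apply]
    field_simp
    ring
  · exact Continuous.intervalIntegrable (by fun_prop) _ _

lemma hasDerivAt_sineIntegralAverage (ε s : ℝ) {x : ℝ} (hx : 0 < x) :
    HasDerivAt (sineIntegralAverage ε s)
      (ε / (x * (ε ^ 2 + x ^ 2))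
        * (Real.exp (ε * s) * (ε * Real.sin (x * s) - x * Real.cos (x * s)) + x)) x := by
  rw [← integral_exp_mul_sinc ε s hx]
  refine (intervalIntegral.hasDerivAt_integral_of_dominated_loc_of_deriv_le
    (F := fun x σ => ε * Real.exp (ε * σ) * sineIntegral (x * σ))
    (F' := fun x σ => ε * Real.exp (ε * σ) * (Real.sinc (x * σ) * σ))
    (bound := fun σ => |ε * Real.exp (ε * σ)| * |σ|) univ_mem ?_ ?_ ?_ ?_ ?_ ?_).2
  · exact Eventually.of_forall fun x => Continuous.aestronglyMeasurable (by fun_prop)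
  · exact Continuous.intervalIntegrable (by fun_prop) _ _
  · exact Continuous.aestronglyMeasurable (by fun_prop)
  · refine ae_of_all _ fun σ _ x _ => ?_
    rw [norm_mul, norm_mul (Real.sinc _)]
    simp only [Real.norm_eq_abs]
    gcongr
    exact mul_le_of_le_one_left (abs_nonneg _) (Real.abs_sinc_le_one _)
  · exact Continuous.intervalIntegrable (by fun_prop) _ _
  · refine ae_of_all _ fun σ _ x _ => ?_
    have hl : HasDerivAt (fun x : ℝ => x * σ) σ x := by
      simpa using (hasDerivAt_id x).mul_const σ
    exact ((hasDerivAt_sineIntegral (x * σ)).comp x hl).const_mul _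

/-- The kernel equals `ε/(ε²+x²) + ∫_0^s e^{εσ} cos(xσ) dσ`. Integrating in `x` gives `arctan(x/ε) +
∫_0^s e^{εσ} sin(xσ)/σ dσ`, and an integration by parts in `σ` brings in `Si(xσ)`. For `ε = 0` the
convention `x/0 = 0` makes the arctan term vanish, as it should. -/
lemma hasDerivAt_dampedPrimitive (ε s : ℝ) {x : ℝ} (hx : 0 < x) :
    HasDerivAt (dampedPrimitive ε s) (dampedKernel ε s x) x := by
  have hl : HasDerivAt (fun x : ℝ => x * s) s x := by
    simpa using (hasDerivAt_id x).mul_const s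
  have hS : HasDerivAt (fun x : ℝ => sineIntegral (x * s)) (Real.sin (x * s) / x) x := by
    have := (hasDerivAt_sineIntegral (x * s)).comp x hl
    convert! this using 1
    rcases eq_or_ne s 0 with rfl | h
    · simp
    · rw [Real.sinc_of_ne_zero (by positivity)]
      field_simp
  have := ((hasDerivAt_arctan_div ε hx).add (hS.const_mul (Real.exp (ε * s)))).sub
    (hasDerivAt_sineIntegralAverage ε s hx)
  convert! this using 1
  have h0 : ε ^ 2 + x ^ 2 ≠ 0 := by positivity
  rw [dampedKernel]
  field_simp
  ring

lemma integral_dampedKernel (ε s : ℝ) {r R : ℝ} (hr : 0 < r) (hrR : r ≤ R) :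
    ∫ x in r..R, dampedKernel ε s x = dampedPrimitive ε s R - dampedPrimitive ε s r := by
  have hpos : ∀ x ∈ Set.uIcc r R, 0 < x := fun x hx => by
    rw [Set.uIcc_of_le hrR] at hx; linarith [hx.1]
  refine intervalIntegral.integral_eq_sub_of_hasDerivAt
    (fun x hx => hasDerivAt_dampedPrimitive ε s (hpos x hx)) ?_
  refine ContinuousOn.intervalIntegrable ?_
  unfold dampedKernel
  refine ContinuousOn.mul (by fun_prop) (ContinuousOn.div (by fun_prop) (by fun_prop) ?_)
  intro x hx
  have := hpos x hx
  positivity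

/-- Away from the pole the kernel is controlled by `e^{εs}` alone, which is what Fubini on `[r, R]`
needs. -/
lemma abs_dampedKernel_le (ε s : ℝ) {r x : ℝ} (hr : 0 < r) (hrx : r ≤ x) :
    |dampedKernel ε s x| ≤ 2 * Real.exp (ε * s) / r := by
  have hx : 0 < x := by linarith
  have h0 : 0 < ε ^ 2 + x ^ 2 := by positivity
  have h1 : |x * Real.sin (x * s) + ε * Real.cos (x * s)| ≤ x + |ε| := by
    refine (abs_add_le _ _).trans ?_
    rw [abs_mul, abs_mul, abs_of_pos hx]
    exact add_le_add (mul_le_of_le_one_right hx.le (Real.abs_sin_le_one _))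
      (mul_le_of_le_one_right (abs_nonneg _) (Real.abs_cos_le_one _))
  have h2 : (x + |ε|) / (ε ^ 2 + x ^ 2) ≤ 2 / r := by
    rw [div_le_div_iff₀ h0 hr]
    rw [← sq_abs ε]
    have := abs_nonneg ε
    nlinarith [sq_nonneg (x - |ε|), mul_le_mul_of_nonneg_left hrx hx.le,
      mul_le_mul_of_nonneg_left hrx this]
  rw [dampedKernel, abs_mul, Real.abs_exp, abs_div, abs_of_pos h0, mul_comm (2 : ℝ), mul_div_assoc]
  exact mul_le_mul_of_nonneg_left ((div_le_div_of_nonneg_right h1 h0.le).trans h2)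
    (Real.exp_pos _).le

/-- The bound is uniform in `x`, and its two summands `1` and `e^{εs}` correspond to the two moment
assumptions, at `ψ_j` and at `ψ_j + εβ`. -/
lemma abs_dampedPrimitive_le (ε s x : ℝ) :
    |dampedPrimitive ε s x| ≤ (2 * Real.pi + 4) * (1 + Real.exp (ε * s)) := by
  have hpi := Real.pi_pos
  have he := Real.exp_pos (ε * s)
  have h1 : |Real.arctan (x / ε)| ≤ Real.pi / 2 :=
    abs_le.2 ⟨(Real.neg_pi_div_two_lt_arctan _).le, (Real.arctan_lt_pi_div_two _).le⟩
  have h2 : |Real.exp (ε * s) * sineIntegral (x * s)| ≤ Real.exp (ε * s) * (Real.pi / 2 + 2) := by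
    rw [abs_mul, Real.abs_exp]
    gcongr
    exact abs_sineIntegral_le _
  have h3 : |sineIntegralAverage ε s x| ≤ (Real.pi / 2 + 2) * (1 + Real.exp (ε * s)) := by
    have hb : |sineIntegralAverage ε s x|
        ≤ |∫ σ in (0 : ℝ)..s, (Real.pi / 2 + 2) * abs (ε * Real.exp (ε * σ))| := by
      have hg : IntervalIntegrable
          (fun σ => (Real.pi / 2 + 2) * abs (ε * Real.exp (ε * σ))) volume 0 s :=
        Continuous.intervalIntegrable (by fun_prop) _ _
      rw [← Real.norm_eq_abs, sineIntegralAverage]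
      refine intervalIntegral.norm_integral_le_abs_of_norm_le (ae_of_all _ fun σ => ?_) hg
      rw [Real.norm_eq_abs, abs_mul, mul_comm]
      gcongr
      exact abs_sineIntegral_le _
    refine hb.trans ?_
    rw [intervalIntegral.integral_const_mul, abs_mul, abs_of_pos (by positivity)]
    gcongr
    -- The integrand has constant sign, that of `ε`, so the absolute value moves outside the
    -- integral.
    have : |∫ σ in (0 : ℝ)..s, abs (ε * Real.exp (ε * σ))| = |Real.exp (ε * s) - 1| := by
      rw [← integral_mul_exp_mul]
      rcases le_total 0 ε with h | h
      · congr 1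
        refine intervalIntegral.integral_congr fun σ _ => ?_
        exact abs_of_nonneg (by positivity)
      · rw [← abs_neg, ← intervalIntegral.integral_neg]
        congr 1
        refine intervalIntegral.integral_congr fun σ _ => ?_
        rw [abs_of_nonpos (mul_nonpos_of_nonpos_of_nonneg h (Real.exp_pos _).le), neg_neg]
    rw [this]
    exact abs_le.2 ⟨by linarith, by linarith⟩
  rw [dampedPrimitive]
  have h4 := abs_sub (Real.arctan (x / ε) + Real.exp (ε * s) * sineIntegral (x * s))
    (sineIntegralAverage ε s x)
  have h5 := abs_add_le (Real.arctan (x / ε)) (Real.exp (ε * s) * sineIntegral (x * s))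
  nlinarith [mul_pos hpi he]

/-- Every nonzero `σ` between `0` and `s` has the sign of `s`, so `Si(xσ)` has a common limit there.
The filter is left general to serve both `x → ∞` and `x ↓ 0`. -/
lemma tendsto_sineIntegralAverage (ε s c : ℝ) {l : Filter ℝ} [l.IsCountablyGenerated]
    (h : ∀ σ ≠ 0, SignType.sign σ = SignType.sign s →
      Tendsto (fun x => sineIntegral (x * σ)) l (𝓝 c)) :
    Tendsto (sineIntegralAverage ε s) l (𝓝 ((Real.exp (ε * s) - 1) * c)) := by
  rw [← integral_mul_exp_mul, ← intervalIntegral.integral_mul_const]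
  refine intervalIntegral.tendsto_integral_filter_of_dominated_convergence
    (fun σ => |ε * Real.exp (ε * σ)| * (Real.pi / 2 + 2)) ?_ ?_ ?_ ?_
  · exact Eventually.of_forall fun x => Continuous.aestronglyMeasurable (by fun_prop)
  · refine Eventually.of_forall fun x => ae_of_all _ fun σ _ => ?_
    rw [norm_mul]
    exact mul_le_mul_of_nonneg_left (abs_sineIntegral_le _) (abs_nonneg _)
  · exact Continuous.intervalIntegrable (by fun_prop) _ _
  -- For `s ≤ 0` the interval `(s, 0]` contains `0`, where the sign differs; that point is null.
  · have h0 : ∀ᵐ σ : ℝ, σ ≠ 0 := by simp [ae_iff]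
    filter_upwards [h0] with σ hσ hm
    refine (h σ hσ ?_).const_mul _
    rcases le_total 0 s with hs | hs
    · rw [Set.uIoc_of_le hs] at hm
      rw [sign_pos hm.1, sign_pos (hm.1.trans_le hm.2)]
    · rw [Set.uIoc_of_ge hs] at hm
      have : σ < 0 := lt_of_le_of_ne hm.2 hσ
      rw [sign_neg this, sign_neg (hm.1.trans this)]

lemma tendsto_arctan_div_atTop (ε : ℝ) :
    Tendsto (fun x => Real.arctan (x / ε)) atTop (𝓝 (SignType.sign ε * (Real.pi / 2))) := by
  rcases lt_trichotomy ε 0 with h | rfl | h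
  · rw [sign_neg h]
    have := (Real.tendsto_arctan_atBot.mono_right nhdsWithin_le_nhds).comp
      (tendsto_id.atTop_div_const_of_neg h)
    simpa [Function.comp_def] using this
  · simp
  · rw [sign_pos h]
    have := (Real.tendsto_arctan_atTop.mono_right nhdsWithin_le_nhds).comp
      (tendsto_id.atTop_div_const h)
    simpa [Function.comp_def] using this

/-- The exponential weights cancel: `e^{εs} c - (e^{εs} - 1) c = c` with `c = sgn(s) π/2`, so the
limit sees only the signs. -/
lemma tendsto_dampedPrimitive_atTop (ε s : ℝ) :
    Tendsto (dampedPrimitive ε s) atTop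
      (𝓝 ((SignType.sign ε + SignType.sign s) * (Real.pi / 2))) := by
  have h := ((tendsto_arctan_div_atTop ε).add
    ((tendsto_sineIntegral_mul_atTop s).const_mul (Real.exp (ε * s)))).sub
    (tendsto_sineIntegralAverage ε s (SignType.sign s * (Real.pi / 2)) (l := atTop)
      fun σ _ hs => hs ▸ tendsto_sineIntegral_mul_atTop σ)
  convert! h using 2
  ring

lemma tendsto_dampedPrimitive_zero (ε s : ℝ) :
    Tendsto (dampedPrimitive ε s) (𝓝[>] 0) (𝓝 0) := by
  have hS : ∀ σ, Tendsto (fun x => sineIntegral (x * σ)) (𝓝[>] 0) (𝓝 0) := fun σ => by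
    have : Continuous fun x => sineIntegral (x * σ) := by fun_prop
    simpa using (this.tendsto 0).mono_left nhdsWithin_le_nhds
  have hA : Tendsto (fun x => Real.arctan (x / ε)) (𝓝[>] 0) (𝓝 0) := by
    have : Continuous fun x => Real.arctan (x / ε) :=
      Real.continuous_arctan.comp (continuous_id.div_const ε)
    simpa using (this.tendsto 0).mono_left nhdsWithin_le_nhds
  have h := (hA.add ((hS s).const_mul (Real.exp (ε * s)))).sub
    (tendsto_sineIntegralAverage ε s 0 fun σ _ _ => hS σ)
  simpa using! h

lemma measurable_dampedPrimitive (ε x : ℝ) : Measurable fun s => dampedPrimitive ε s x := by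
  have : Continuous fun s => sineIntegralAverage ε s x :=
    intervalIntegral.continuous_primitive
      (fun a b => Continuous.intervalIntegrable (by fun_prop) _ _) 0
  have : Continuous fun s => dampedPrimitive ε s x := by
    unfold dampedPrimitive
    fun_prop
  exact this.measurable

end MultiCurve

namespace MultiCurve

/-! ### Fourier inversion for a damped finite measure -/

/-- On the contour `iζ = ε + ix`. -/
lemma fourierKernel_re (ε α z x : ℝ) :
    (Complex.exp (-Complex.I * contourPoint ε x * (α : ℂ)) / (Complex.I * contourPoint ε x)
      * Complex.exp (Complex.I * contourPoint ε x * (z : ℂ))).re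
      = dampedKernel ε (z - α) x := by
  have h1 : Complex.exp (-Complex.I * contourPoint ε x * (α : ℂ))
        / (Complex.I * contourPoint ε x) * Complex.exp (Complex.I * contourPoint ε x * (z : ℂ))
      = Complex.exp (((ε * (z - α) : ℝ) : ℂ) + ((x * (z - α) : ℝ) : ℂ) * Complex.I)
        / ((ε : ℂ) + (x : ℂ) * Complex.I) := by
    have h2 : Complex.I * contourPoint ε x = (ε : ℂ) + (x : ℂ) * Complex.I := by
      rw [contourPoint]
      linear_combination (-(ε : ℂ)) * Complex.I_mul_I
    rw [div_mul_eq_mul_div, ← Complex.exp_add, neg_mul, h2]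
    congr 2
    push_cast
    ring
  rw [h1, Complex.div_re, Complex.exp_re, Complex.exp_im, dampedKernel]
  simp only [Complex.normSq_apply, Complex.add_re, Complex.add_im, Complex.ofReal_re,
    Complex.ofReal_im, Complex.mul_re, Complex.mul_im, Complex.I_re, Complex.I_im]
  simp only [mul_zero, mul_one, sub_zero, add_zero, zero_add]
  rw [← sq, ← sq]
  ring

lemma measurable_dampedKernel (ε : ℝ) :
    Measurable fun q : ℝ × ℝ => dampedKernel ε q.1 q.2 := by
  unfold dampedKernel
  fun_prop

variable {E : Type*} [MeasurableSpace E]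

lemma integrable_dampedKernel_prod {ν : Measure E} [IsFiniteMeasure ν] {y z : E → ℝ}
    (hym : Measurable y) (hzm : Measurable z) {ε : ℝ}
    (hyε : Integrable (fun ξ => y ξ * Real.exp (ε * z ξ)) ν) (α : ℝ) {r R : ℝ} (hr : 0 < r) :
    Integrable (fun q : ℝ × E => y q.2 * dampedKernel ε (z q.2 - α) q.1)
      ((volume.restrict (Set.Ioc r R)).prod ν) := by
  have hg : Integrable (fun q : ℝ × E =>
      (2 / r * Real.exp (-(ε * α))) * ‖y q.2 * Real.exp (ε * z q.2)‖)
      ((volume.restrict (Set.Ioc r R)).prod ν) :=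
    (hyε.norm.comp_snd _).const_mul _
  refine hg.mono' ?_ ?_
  · refine Measurable.aestronglyMeasurable (Measurable.mul (by fun_prop) ?_)
    exact (measurable_dampedKernel ε).comp
      (((hzm.comp measurable_snd).sub_const α).prodMk measurable_fst)
  · have hx : ∀ᵐ q : ℝ × E ∂((volume.restrict (Set.Ioc r R)).prod ν), q.1 ∈ Set.Ioc r R :=
      Measure.quasiMeasurePreserving_fst.ae (ae_restrict_mem measurableSet_Ioc)
    filter_upwards [hx] with q hq
    have h := abs_dampedKernel_le ε (z q.2 - α) hr hq.1.le
    have he : Real.exp (ε * (z q.2 - α)) = Real.exp (-(ε * α)) * Real.exp (ε * z q.2) := by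
      rw [← Real.exp_add]; ring_nf
    rw [norm_mul, norm_mul, Real.norm_eq_abs, Real.norm_eq_abs, Real.norm_eq_abs, Real.abs_exp]
    calc |y q.2| * |dampedKernel ε (z q.2 - α) q.1|
        ≤ |y q.2| * (2 * Real.exp (ε * (z q.2 - α)) / r) := by gcongr
      _ = _ := by rw [he]; ring

/-- The Fourier integrals of a measure `y dν` along the line with imaginary part `-ε`. -/
theorem hasImproperIntegral_fourierIntegrand {ν : Measure E} [IsFiniteMeasure ν] {y z : E → ℝ}
    (hym : Measurable y) (hzm : Measurable z) {ε : ℝ} (hy : Integrable y ν)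
    (hyε : Integrable (fun ξ => y ξ * Real.exp (ε * z ξ)) ν) (α : ℝ) {F : ℝ → ℂ}
    (hF : ∀ᵐ x : ℝ, 0 < x →
      F x = ∫ ξ, (y ξ : ℂ) * Complex.exp (Complex.I * contourPoint ε x * (z ξ : ℂ)) ∂ν) :
    HasImproperIntegral (fourierIntegrand α ε F)
      (∫ ξ, y ξ * ((SignType.sign ε + SignType.sign (z ξ - α)) * (Real.pi / 2)) ∂ν) := by
  have hi : ∀ x, Integrable
      (fun ξ => (y ξ : ℂ) * Complex.exp (Complex.I * contourPoint ε x * (z ξ : ℂ))) ν := by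
    intro x
    refine hyε.mono (by fun_prop) (ae_of_all _ fun ξ => ?_)
    rw [norm_mul, norm_mul, Complex.norm_real, Complex.norm_exp, Real.norm_eq_abs (Real.exp _),
      Real.abs_exp]
    simp [contourPoint]
  have hFk : ∀ᵐ x : ℝ, 0 < x →
      fourierIntegrand α ε F x = ∫ ξ, y ξ * dampedKernel ε (z ξ - α) x ∂ν := by
    filter_upwards [hF] with x hx h0
    rw [fourierIntegrand, hx h0, ← integral_const_mul]
    rw [← RCLike.re_to_complex, ← integral_re ((hi x).const_mul _)]
    refine integral_congr_ae (ae_of_all _ fun ξ => ?_)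
    simp only
    rw [← fourierKernel_re, ← Complex.re_ofReal_mul, RCLike.re_to_complex]
    congr 1
    ring
  have hFk' : ∀ r R : ℝ, 0 < r → ∀ᵐ x ∂(volume.restrict (Set.Ioc r R)),
      fourierIntegrand α ε F x = ∫ ξ, y ξ * dampedKernel ε (z ξ - α) x ∂ν := by
    intro r R hr
    refine (ae_restrict_iff' measurableSet_Ioc).2 ?_
    filter_upwards [hFk] with x hx hm using hx (hr.trans hm.1)
  set P : ℝ → ℝ := fun x => ∫ ξ, y ξ * dampedPrimitive ε (z ξ - α) x ∂ν with hP
  -- One dominating function for all `x`, used both for `r ↓ 0` and for `R ↑ ∞`.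
  set b : E → ℝ := fun ξ => |y ξ| * ((2 * Real.pi + 4) * (1 + Real.exp (ε * (z ξ - α)))) with hb
  have hbi : Integrable b ν := by
    have : b = fun ξ => (2 * Real.pi + 4) * ‖y ξ‖
        + (2 * Real.pi + 4) * Real.exp (-(ε * α)) * ‖y ξ * Real.exp (ε * z ξ)‖ := by
      funext ξ
      have he : Real.exp (ε * (z ξ - α)) = Real.exp (-(ε * α)) * Real.exp (ε * z ξ) := by
        rw [← Real.exp_add]; ring_nf
      rw [hb, norm_mul, Real.norm_eq_abs, Real.norm_eq_abs, Real.abs_exp]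
      simp only [he]
      ring
    rw [this]
    exact (hy.norm.const_mul _).add (hyε.norm.const_mul _)
  have hbd : ∀ x ξ, ‖y ξ * dampedPrimitive ε (z ξ - α) x‖ ≤ b ξ := by
    intro x ξ
    rw [norm_mul, Real.norm_eq_abs, Real.norm_eq_abs]
    exact mul_le_mul_of_nonneg_left (abs_dampedPrimitive_le _ _ _) (abs_nonneg _)
  have hmeas : ∀ x, AEStronglyMeasurable (fun ξ => y ξ * dampedPrimitive ε (z ξ - α) x) ν :=
    fun x => (hym.mul ((measurable_dampedPrimitive ε x).comp
      (hzm.sub_const α))).aestronglyMeasurable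
  have hPi : ∀ x, Integrable (fun ξ => y ξ * dampedPrimitive ε (z ξ - α) x) ν :=
    fun x => hbi.mono' (hmeas x) (ae_of_all _ (hbd x))
  have hint : ∀ r R : ℝ, 0 < r → r ≤ R →
      ∫ x in r..R, fourierIntegrand α ε F x = P R - P r := by
    intro r R hr hrR
    rw [intervalIntegral.integral_of_le hrR, integral_congr_ae (hFk' r R hr),
      integral_integral_swap (integrable_dampedKernel_prod hym hzm hyε α hr), hP,
      ← integral_sub (hPi R) (hPi r)]
    refine integral_congr_ae (ae_of_all _ fun ξ => ?_)
    simp only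
    rw [integral_const_mul, ← intervalIntegral.integral_of_le hrR, integral_dampedKernel _ _ hr hrR,
      mul_sub]
  have htop : Tendsto P atTop
      (𝓝 (∫ ξ, y ξ * ((SignType.sign ε + SignType.sign (z ξ - α)) * (Real.pi / 2)) ∂ν)) :=
    tendsto_integral_filter_of_dominated_convergence b (Eventually.of_forall hmeas)
      (Eventually.of_forall fun x => ae_of_all _ (hbd x)) hbi
      (ae_of_all _ fun ξ => (tendsto_dampedPrimitive_atTop ε (z ξ - α)).const_mul (y ξ))
  have hzero : Tendsto P (𝓝[>] 0) (𝓝 0) := by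
    have := tendsto_integral_filter_of_dominated_convergence (l := 𝓝[>] 0) b
      (Eventually.of_forall hmeas) (Eventually.of_forall fun x => ae_of_all _ (hbd x)) hbi
      (ae_of_all _ fun ξ => (tendsto_dampedPrimitive_zero ε (z ξ - α)).const_mul (y ξ))
    simpa using this
  refine ⟨fun r R hr hrR => ?_, ?_⟩
  · rw [intervalIntegrable_iff_integrableOn_Ioc_of_le hrR]
    exact (integrable_dampedKernel_prod hym hzm hyε α hr).integral_prod_left.congr
      ((hFk' r R hr).mono fun x hx => hx.symm)
  · have h := (htop.comp (tendsto_snd (f := 𝓝[>] (0 : ℝ)))).sub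
      (hzero.comp (tendsto_fst (g := (atTop : Filter ℝ))))
    rw [sub_zero] at h
    refine h.congr' ?_
    -- Restricting to `r ≤ 1 ≤ R` guarantees `r ≤ R` eventually along the product filter.
    have h1 : ∀ᶠ r : ℝ in 𝓝[>] 0, 0 < r ∧ r ≤ 1 :=
      (eventually_mem_nhdsWithin (a := (0 : ℝ)) (s := Set.Ioi 0)).and
        (eventually_nhdsWithin_of_eventually_nhds (eventually_le_nhds zero_lt_one))
    filter_upwards [h1.prod_mk (eventually_ge_atTop (1 : ℝ))] with q hq
    exact (hint q.1 q.2 hq.1.1 (hq.1.2.trans hq.2)).symm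

/-- The Fourier inversion formula for the restriction of `y dν` to a half space. -/
theorem integral_indicator_eq_residue_add {ν : Measure E} {y z : E → ℝ} (hzm : Measurable z)
    (hy : Integrable y ν) (ε : ℝ) {α : ℝ} (hα : ∀ᵐ ξ ∂ν, z ξ ≠ α) :
    ∫ ξ, {ξ | α < z ξ}.indicator y ξ ∂ν
      = (if ε < 0 then ∫ ξ, y ξ ∂ν else if ε = 0 then 1 / 2 * ∫ ξ, y ξ ∂ν else 0)
        + 1 / Real.pi
          * ∫ ξ, y ξ * ((SignType.sign ε + SignType.sign (z ξ - α)) * (Real.pi / 2)) ∂ν := by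
  have hpi := Real.pi_ne_zero
  -- The three residue cases are the single factor `(1 - sgn ε)/2`, which cancels the `sgn ε` from
  -- the Fourier integral.
  have hr : (if ε < 0 then ∫ ξ, y ξ ∂ν else if ε = 0 then 1 / 2 * ∫ ξ, y ξ ∂ν else 0)
      = ∫ ξ, (1 - (SignType.sign ε : ℝ)) / 2 * y ξ ∂ν := by
    rw [integral_const_mul]
    rcases lt_trichotomy ε 0 with h | rfl | h
    · rw [if_pos h, sign_neg h]; norm_num
    · simp
    · rw [if_neg h.le.not_gt, if_neg h.ne', sign_pos h]; norm_num
  have hs : Measurable fun ξ => ((SignType.sign (z ξ - α) : SignType) : ℝ) := by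
    have : (fun ξ => ((SignType.sign (z ξ - α) : SignType) : ℝ))
        = fun ξ => if 0 < z ξ - α then 1 else if z ξ - α < 0 then -1 else 0 := by
      funext ξ
      rw [sign_apply]
      split_ifs <;> simp
    rw [this]
    refine Measurable.ite (measurableSet_lt (by fun_prop) (by fun_prop)) (by fun_prop) ?_
    exact Measurable.ite (measurableSet_lt (by fun_prop) (by fun_prop)) (by fun_prop) (by fun_prop)
  have hb : ∀ a : SignType, |(a : ℝ)| ≤ 1 := by intro a; cases a <;> simp
  have hi : Integrable
      (fun ξ => y ξ * ((SignType.sign ε + SignType.sign (z ξ - α)) * (Real.pi / 2))) ν := by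
    refine hy.mul_bdd (c := 2 * (Real.pi / 2))
      ((hs.const_add _).mul_const _).aestronglyMeasurable (ae_of_all _ fun ξ => ?_)
    rw [Real.norm_eq_abs, abs_mul, abs_of_pos (by positivity : 0 < Real.pi / 2)]
    gcongr
    exact (abs_add_le _ _).trans (by linarith [hb (SignType.sign ε), hb (SignType.sign (z ξ - α))])
  rw [hr, ← integral_const_mul, ← integral_add (hy.const_mul _) (hi.const_mul _)]
  refine integral_congr_ae ?_
  filter_upwards [hα] with ξ hξ
  rcases lt_or_gt_of_ne hξ with h | h
  · rw [Set.indicator_of_notMem (by simpa using h.le), sign_neg (sub_neg.2 h)]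
    simp only [SignType.coe_neg_one]
    field_simp
    ring
  · rw [Set.indicator_of_mem (by simpa using h), sign_pos (sub_pos.2 h)]
    simp only [SignType.coe_one]
    field_simp
    ring

end MultiCurve

namespace MultiCurve

/-! ### Conditional expectations of functions of a Markov process -/

section Markov

variable {Ω : Type*} [mΩ : MeasurableSpace Ω] {μ : Measure Ω}
  {ℱ : Filtration ℝ≥0 mΩ}
  {V : Type*} [NormedAddCommGroup V] [InnerProductSpace ℝ V] [MeasurableSpace V]
  {𝕋 : ℝ≥0} {D : Set V} {p : ℝ≥0 → Kernel D D} {X : ℝ≥0 → Ω → D}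

namespace IsMarkovProcess

lemma measurable (hX : IsMarkovProcess μ ℱ 𝕋 D p X) {t : ℝ≥0} (ht : t ≤ 𝕋) : Measurable (X t) :=
  (hX.adapted t ht).mono (ℱ.le t) le_rfl

variable [IsProbabilityMeasure μ]

/-- Integrating the Markov property of each set `B` over a past event `A` turns it into an identity
of measures, free of the exceptional sets depending on `B`. It then extends from indicators to
integrable functions. -/
lemma map_restrict_eq (hX : IsMarkovProcess μ ℱ 𝕋 D p X) {s t : ℝ≥0} (hst : s ≤ t) (ht : t ≤ 𝕋)
    {A : Set Ω} (hA : MeasurableSet[ℱ s] A) :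
    (μ.restrict A).map (X t)
      = (p (t - s)).comap (X s) (hX.measurable (hst.trans ht)) ∘ₘ (μ.restrict A) := by
  have hp : IsMarkovKernel (p (t - s)) := hX.conservative _ (tsub_le_self.trans ht)
  have hmt := hX.measurable ht
  ext B hB
  rw [Measure.map_apply hmt hB, Measure.bind_apply hB (Kernel.aemeasurable _),
    ← ENNReal.toReal_eq_toReal_iff' (measure_ne_top _ _)]
  swap
  · refine ne_of_lt (lt_of_le_of_lt (lintegral_mono (g := fun _ => 1) fun ω => prob_le_one) ?_)
    simp
  have h1 : ∫ ω in A, (X t ⁻¹' B).indicator (fun _ => (1 : ℝ)) ω ∂μ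
      = ∫ ω in A, (p (t - s) (X s ω)).real B ∂μ := by
    rw [← setIntegral_condExp (ℱ.le s) ((integrable_const (1 : ℝ)).indicator (hmt hB)) hA]
    exact setIntegral_congr_ae (ℱ.le s _ hA)
      ((hX.markov s t hst ht B hB).mono fun ω hω _ => hω)
  rw [integral_indicator_const _ (hmt hB), smul_eq_mul, mul_one] at h1
  rw [Measure.real] at h1
  rw [h1, ← integral_toReal]
  · rfl
  · exact (Kernel.measurable_coe _ hB).aemeasurable
  · exact ae_of_all _ fun ω => measure_lt_top _ _

lemma map_eq (hX : IsMarkovProcess μ ℱ 𝕋 D p X) {s t : ℝ≥0} (hst : s ≤ t) (ht : t ≤ 𝕋) :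
    μ.map (X t) = (p (t - s)).comap (X s) (hX.measurable (hst.trans ht)) ∘ₘ μ := by
  simpa using hX.map_restrict_eq hst ht (A := Set.univ) MeasurableSet.univ

/-- The law of `X_t` is a mixture of transition laws, so its null sets are null for almost all of
them. This transfers `⟨β, X_T⟩ ≠ α` to the transition law. -/
lemma ae_ae_transition (hX : IsMarkovProcess μ ℱ 𝕋 D p X) {s t : ℝ≥0} (hst : s ≤ t) (ht : t ≤ 𝕋)
    {P : D → Prop} (hPm : MeasurableSet {x | P x}) (hP : ∀ᵐ ω ∂μ, P (X t ω)) :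
    ∀ᵐ ω ∂μ, ∀ᵐ ξ ∂(p (t - s) (X s ω)), P ξ := by
  have h : ∀ᵐ ξ ∂(μ.map (X t)), P ξ := (ae_map_iff (hX.measurable ht).aemeasurable hPm).2 hP
  rw [hX.map_eq hst ht] at h
  filter_upwards [Measure.ae_ae_of_ae_comp h] with ω hω
  rwa [Kernel.comap_apply] at hω

lemma ae_integrable_transition {F : Type*} [NormedAddCommGroup F]
    (hX : IsMarkovProcess μ ℱ 𝕋 D p X) {s t : ℝ≥0}
    (hst : s ≤ t) (ht : t ≤ 𝕋) {f : D → F} (hfm : StronglyMeasurable f)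
    (hf : Integrable (fun ω => f (X t ω)) μ) :
    ∀ᵐ ω ∂μ, Integrable f (p (t - s) (X s ω)) := by
  have h : Integrable f (μ.map (X t)) :=
    (integrable_map_measure hfm.aestronglyMeasurable (hX.measurable ht).aemeasurable).2 hf
  rw [hX.map_eq hst ht] at h
  filter_upwards [Measure.ae_integrable_of_integrable_comp h] with ω hω
  rwa [Kernel.comap_apply] at hω

/-- The Markov property for integrable functions. -/
theorem condExp_comp {F : Type*} [NormedAddCommGroup F] [NormedSpace ℝ F] [CompleteSpace F]
    (hX : IsMarkovProcess μ ℱ 𝕋 D p X) {s t : ℝ≥0} (hst : s ≤ t) (ht : t ≤ 𝕋)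
    {f : D → F} (hfm : StronglyMeasurable f) (hf : Integrable (fun ω => f (X t ω)) μ) :
    μ[fun ω => f (X t ω) | ℱ s] =ᵐ[μ] fun ω => ∫ ξ, f ξ ∂(p (t - s) (X s ω)) := by
  have hp : IsMarkovKernel (p (t - s)) := hX.conservative _ (tsub_le_self.trans ht)
  have hm := (hX.measurable ht).aemeasurable (μ := μ)
  have hg : StronglyMeasurable[ℱ s] fun ω => ∫ ξ, f ξ ∂(p (t - s) (X s ω)) :=
    (StronglyMeasurable.integral_kernel (κ := p (t - s)) hfm).comp_measurable
      (hX.adapted s (hst.trans ht))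
  have hint : Integrable f (μ.map (X t)) :=
    (integrable_map_measure hfm.aestronglyMeasurable hm).2 hf
  have hnorm : Integrable (fun ω => ∫ ξ, ‖f ξ‖ ∂(p (t - s) (X s ω))) μ := by
    rw [hX.map_eq hst ht] at hint
    exact Measure.integrable_integral_norm_of_integrable_comp hint
  have hgi : Integrable (fun ω => ∫ ξ, f ξ ∂(p (t - s) (X s ω))) μ :=
    hnorm.mono' (hg.mono (ℱ.le s)).aestronglyMeasurable
      (ae_of_all _ fun ω => norm_integral_le_integral_norm _)
  -- The kernel integral is `ℱ s`-measurable and integrable; uniqueness leaves equality of integrals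
  -- over past events, which `map_restrict_eq` supplies.
  refine (ae_eq_condExp_of_forall_setIntegral_eq (ℱ.le s) hf (fun _ _ _ => hgi.integrableOn)
    (fun A hA _ => ?_) hg.aestronglyMeasurable).symm
  have hmA := (hX.measurable ht).aemeasurable (μ := μ.restrict A)
  have hiA : Integrable f ((μ.restrict A).map (X t)) :=
    (integrable_map_measure hfm.aestronglyMeasurable hmA).2 hf.integrableOn
  rw [← integral_map hmA hfm.aestronglyMeasurable]
  rw [hX.map_restrict_eq hst ht hA, Measure.comp_eq_comp_const_apply] at hiA ⊢
  rw [Kernel.integral_comp hiA]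
  simp

end IsMarkovProcess

end Markov

/-! ### Conditional transforms -/

section Transform

variable {V : Type*} [NormedAddCommGroup V] [InnerProductSpace ℝ V]

lemma cpair_add (ζ η : V × V) (x : V) : cpair (ζ + η) x = cpair ζ x + cpair η x := by
  simp only [cpair, Prod.fst_add, Prod.snd_add, inner_add_left]
  push_cast
  ring

lemma cpair_cmul (z : ℂ) (b x : V) : cpair (cmul z b) x = z * ((inner ℝ b x : ℝ) : ℂ) := by
  simp only [cpair, cmul, real_inner_smul_left]
  push_cast
  conv_rhs => rw [← Complex.re_add_im z]
  ring

lemma cpair_ofReal (a x : V) : cpair (a, 0) x = ((inner ℝ a x : ℝ) : ℂ) := by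
  simp [cpair]

@[fun_prop]
lemma continuous_cpair (ζ : V × V) : Continuous (cpair ζ) := by
  unfold cpair
  fun_prop

lemma exp_add_cpair_contour (c : ℂ) (b : V × V) (β : V) (ε x : ℝ) (ξ : V) :
    Complex.exp (c + cpair (b + cmul (Complex.I * contourPoint ε x) β) ξ)
      = Complex.exp (c + cpair b ξ)
        * Complex.exp (Complex.I * contourPoint ε x * ((inner ℝ β ξ : ℝ) : ℂ)) := by
  rw [cpair_add, cpair_cmul, ← add_assoc, Complex.exp_add]

/-- The modulus does not depend on `x`, so integrability at the single point `ψ_j + εβ` covers the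
whole contour. -/
lemma norm_exp_mul_contour (w : ℂ) (ε x a : ℝ) :
    ‖w * Complex.exp (Complex.I * contourPoint ε x * (a : ℂ))‖
      = ‖w‖ * Real.exp (ε * a) := by
  rw [norm_mul, Complex.norm_exp]
  simp [contourPoint]

end Transform

end MultiCurve

namespace MultiCurve

/-! ### Fourier inversion for one exponential leg -/

section Leg

variable {Ω : Type*} [mΩ : MeasurableSpace Ω] {μ : Measure Ω}
  {ℱ : Filtration ℝ≥0 mΩ}
  {V : Type*} [NormedAddCommGroup V] [InnerProductSpace ℝ V] [MeasurableSpace V] [BorelSpace V]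
  {𝕋 : ℝ≥0} {D : Set V} {p : ℝ≥0 → Kernel D D} {X : ℝ≥0 → Ω → D}

lemma measurable_inner_coe (β : V) : Measurable fun ξ : D => (inner ℝ β (ξ : V) : ℝ) := by
  have : Continuous fun ξ : D => (inner ℝ β (ξ : V) : ℝ) := by fun_prop
  exact this.measurable

lemma measurable_cpair_coe (ζ : V × V) : Measurable fun ξ : D => cpair ζ (ξ : V) :=
  ((continuous_cpair ζ).comp continuous_subtype_val).measurable

/-- The conditional transform along the contour, computed with the transition kernel. -/
noncomputable def kernelTransform (p : ℝ≥0 → Kernel D D) (X : ℝ≥0 → Ω → D) (t T : ℝ≥0)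
    (c : ℂ) (b : V × V) (β : V) (ε x : ℝ) (ω : Ω) : ℂ :=
  ∫ ξ : D, Complex.exp (c + cpair b (ξ : V))
    * Complex.exp (Complex.I * contourPoint ε x * ((inner ℝ β (ξ : V) : ℝ) : ℂ))
    ∂(p (T - t) (X t ω))

lemma measurable_kernelTransform (hX : IsMarkovProcess μ ℱ 𝕋 D p X) {t T : ℝ≥0} (htT : t ≤ T)
    (hT : T ≤ 𝕋) (c : ℂ) (b : V × V) (β : V) (ε : ℝ) :
    Measurable (Function.uncurry (kernelTransform p X t T c b β ε)) := by
  have hp : IsMarkovKernel (p (T - t)) := hX.conservative _ (tsub_le_self.trans hT)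
  have hXt : Measurable fun q : ℝ × Ω => X t q.2 :=
    (hX.measurable (htT.trans hT)).comp measurable_snd
  have hf : Measurable fun q : (ℝ × Ω) × D => Complex.exp (c + cpair b (q.2 : V))
      * Complex.exp (Complex.I * contourPoint ε q.1.1 * ((inner ℝ β (q.2 : V) : ℝ) : ℂ)) := by
    have h1 : Measurable fun q : (ℝ × Ω) × D => cpair b (q.2 : V) :=
      (measurable_cpair_coe b).comp measurable_snd
    have h2 : Measurable fun q : (ℝ × Ω) × D => (inner ℝ β (q.2 : V) : ℝ) :=
      (measurable_inner_coe β).comp measurable_snd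
    unfold contourPoint
    fun_prop
  exact (hf.stronglyMeasurable.integral_kernel_prod_right'
    (κ := (p (T - t)).comap _ hXt)).measurable

lemma integrable_exp_mul_contour {T : ℝ≥0} (hXT : Measurable (X T)) (c : ℂ) {b : V × V} {β : V}
    {ε : ℝ} (hbε : b + cmul (ε : ℂ) β ∈ expMomentSet μ X T) (x : ℝ) :
    Integrable (fun ω => Complex.exp (c + cpair b (X T ω : V))
      * Complex.exp (Complex.I * contourPoint ε x * ((inner ℝ β (X T ω : V) : ℝ) : ℂ))) μ := by
  have h := (hbε T le_rfl).const_mul (Complex.exp c)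
  have h1 := (measurable_cpair_coe (D := D) b).comp hXT
  have h2 := (measurable_inner_coe (D := D) β).comp hXT
  simp only [Function.comp_def] at h1 h2
  refine h.mono (by fun_prop) (ae_of_all _ fun ω => ?_)
  have he : Complex.exp c * Complex.exp (cpair (b + cmul (ε : ℂ) β) (X T ω : V))
      = Complex.exp (c + cpair b (X T ω : V))
        * Complex.exp ((ε * inner ℝ β (X T ω : V) : ℝ) : ℂ) := by
    rw [cpair_add, cpair_cmul, ← Complex.exp_add, ← Complex.exp_add, Complex.ofReal_mul, add_assoc]
  rw [norm_exp_mul_contour, he, norm_mul, Complex.norm_exp_ofReal]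

variable [IsProbabilityMeasure μ]

lemma kernelTransform_ae_eq (hX : IsMarkovProcess μ ℱ 𝕋 D p X) {t T : ℝ≥0} (htT : t ≤ T)
    (hT : T ≤ 𝕋) (c : ℂ) {b : V × V} {β : V} {ε : ℝ}
    (hbε : b + cmul (ε : ℂ) β ∈ expMomentSet μ X T) (x : ℝ) :
    kernelTransform p X t T c b β ε x =ᵐ[μ] condTransform μ ℱ t (fun ω => (X T ω : V)) c
      (b + cmul (Complex.I * contourPoint ε x) β) := by
  have h1 := measurable_cpair_coe (D := D) b
  have h2 := measurable_inner_coe (D := D) β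
  have hf : Measurable fun ξ : D => Complex.exp (c + cpair b (ξ : V))
      * Complex.exp (Complex.I * contourPoint ε x * ((inner ℝ β (ξ : V) : ℝ) : ℂ)) := by fun_prop
  have h := hX.condExp_comp htT hT hf.stronglyMeasurable
    (integrable_exp_mul_contour (hX.measurable hT) c hbε x)
  simp only [condTransform, exp_add_cpair_contour]
  exact h.symm

theorem isTransformVersion_kernelTransform (hX : IsMarkovProcess μ ℱ 𝕋 D p X) {t T : ℝ≥0}
    (htT : t ≤ T) (hT : T ≤ 𝕋) (c : ℂ) {b : V × V} {β : V} {ε : ℝ}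
    (hbε : b + cmul (ε : ℂ) β ∈ expMomentSet μ X T) :
    IsTransformVersion μ ℱ t (fun ω => (X T ω : V)) c b β ε (kernelTransform p X t T c b β ε) :=
  ⟨measurable_kernelTransform hX htT hT c b β ε,
    fun x _ => kernelTransform_ae_eq hX htT hT c hbε x⟩

/-- For each `x` the two versions agree off a null set depending on `x`. Joint measurability of both
allows the quantifiers to be exchanged by Fubini; agreement for almost every `x` suffices for the
Fourier integrals. -/
lemma IsTransformVersion.ae_eq_kernelTransform (hX : IsMarkovProcess μ ℱ 𝕋 D p X) {t T : ℝ≥0}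
    (htT : t ≤ T) (hT : T ≤ 𝕋) {c : ℂ} {b : V × V} {β : V} {ε : ℝ}
    (hbε : b + cmul (ε : ℂ) β ∈ expMomentSet μ X T) {Φ : ℝ → Ω → ℂ}
    (hΦ : IsTransformVersion μ ℱ t (fun ω => (X T ω : V)) c b β ε Φ) :
    ∀ᵐ ω ∂μ, ∀ᵐ x : ℝ, 0 < x → Φ x ω = kernelTransform p X t T c b β ε x ω := by
  have hm : MeasurableSet {q : ℝ × Ω | 0 < q.1 →
      Φ q.1 q.2 = kernelTransform p X t T c b β ε q.1 q.2} := by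
    have h1 : MeasurableSet {q : ℝ × Ω | 0 < q.1} := measurableSet_lt measurable_const measurable_fst
    have h2 : MeasurableSet {q : ℝ × Ω |
        Φ q.1 q.2 = kernelTransform p X t T c b β ε q.1 q.2} :=
      measurableSet_eq_fun hΦ.1 (measurable_kernelTransform hX htT hT c b β ε)
    convert! h1.compl.union h2 using 1
    ext q
    simp [imp_iff_not_or]
  refine (Measure.ae_ae_comm hm).1 (ae_of_all _ fun x => ?_)
  by_cases hx : 0 < x
  · filter_upwards [hΦ.2 x hx, kernelTransform_ae_eq hX htT hT c hbε x] with ω h1 h2 _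
    rw [h1, h2]
  · exact ae_of_all _ fun ω h => absurd h hx

/-- The Fourier inversion formula for one exponential term of the payoff. -/
theorem exists_hasImproperIntegral_leg (hX : IsMarkovProcess μ ℱ 𝕋 D p X) {t T : ℝ≥0}
    (htT : t ≤ T) (hT : T ≤ 𝕋) {c : ℂ} {b : V × V} {β : V} {α ε : ℝ}
    (hα : ∀ᵐ ω ∂μ, inner ℝ β (X T ω : V) ≠ α)
    (hb : b ∈ expMomentSet μ X T) (hbε : b + cmul (ε : ℂ) β ∈ expMomentSet μ X T)
    {y : D → ℝ} (hy : ∀ ξ : D, Complex.exp (c + cpair b (ξ : V)) = (y ξ : ℂ)) {Φ : ℝ → Ω → ℂ}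
    (hΦ : IsTransformVersion μ ℱ t (fun ω => (X T ω : V)) c b β ε Φ) :
    ∀ᵐ ω ∂μ, ∃ J : ℝ, HasImproperIntegral (fourierIntegrand α ε (fun x => Φ x ω)) J ∧
      ((μ[{ω' | α < inner ℝ β (X T ω' : V)}.indicator (fun ω' => y (X T ω')) | ℱ t] ω : ℝ) : ℂ)
        = residue μ ℱ t (fun ω' => (X T ω' : V)) c b ε ω + 1 / (Real.pi : ℂ) * (J : ℂ) := by
  have hXT := hX.measurable hT
  have hmc := measurable_cpair_coe (D := D) b
  have hz := measurable_inner_coe (D := D) β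
  have hyre : y = fun ξ : D => (Complex.exp (c + cpair b (ξ : V))).re := by
    funext ξ
    rw [hy, Complex.ofReal_re]
  have hym : Measurable y := by
    rw [hyre]
    fun_prop
  have hyi : Integrable (fun ω => (y (X T ω) : ℂ)) μ := by
    simp only [← hy, Complex.exp_add]
    exact (hb T le_rfl).const_mul _
  have hyi' : Integrable (fun ω => y (X T ω)) μ := by simpa using hyi.re
  have hyε : Integrable (fun ω => y (X T ω) * Real.exp (ε * inner ℝ β (X T ω : V))) μ := by
    have h := integrable_exp_mul_contour hXT c hbε 0
    have hm : Measurable fun ξ : D => y ξ * Real.exp (ε * inner ℝ β (ξ : V)) := by fun_prop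
    refine h.mono (hm.comp hXT).aestronglyMeasurable (ae_of_all _ fun ω => ?_)
    rw [norm_exp_mul_contour, hy, norm_mul, Complex.norm_real, Real.norm_eq_abs (Real.exp _),
      Real.abs_exp]
  have hS : MeasurableSet {ξ : D | α < inner ℝ β (ξ : V)} := measurableSet_lt measurable_const hz
  have hind := hX.condExp_comp htT hT (f := {ξ : D | α < inner ℝ β (ξ : V)}.indicator y)
    (hym.indicator hS).stronglyMeasurable (hyi'.indicator (hXT hS))
  have hres := hX.condExp_comp htT hT (f := fun ξ : D => Complex.exp (c + cpair b (ξ : V)))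
    (Measurable.stronglyMeasurable (by fun_prop)) (by simpa only [hy] using hyi)
  have hp : IsMarkovKernel (p (T - t)) := hX.conservative _ (tsub_le_self.trans hT)
  filter_upwards [hΦ.ae_eq_kernelTransform hX htT hT hbε, hind, hres,
    hX.ae_integrable_transition htT hT hym.stronglyMeasurable hyi',
    hX.ae_integrable_transition htT hT
      (f := fun ξ : D => y ξ * Real.exp (ε * inner ℝ β (ξ : V)))
      (Measurable.stronglyMeasurable (by fun_prop)) hyε,
    hX.ae_ae_transition htT hT (P := fun ξ : D => inner ℝ β (ξ : V) ≠ α)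
      (measurableSet_eq_fun hz measurable_const).compl hα] with ω h1 h2 h3 h4 h5 h6
  -- With `ω` fixed, the deterministic inversion is applied to the transition law from `X_t(ω)`.
  refine ⟨_, hasImproperIntegral_fourierIntegrand hym hz h4 h5 α ?_, ?_⟩
  · filter_upwards [h1] with x hx h0
    rw [hx h0, kernelTransform]
    simp only [hy]
  · have h7 : condTransform μ ℱ t (fun ω' => (X T ω' : V)) c b ω
        = ((∫ ξ, y ξ ∂(p (T - t) (X t ω)) : ℝ) : ℂ) := by
      rw [condTransform, h3, ← integral_complex_ofReal]
      simp only [hy]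
    have h8 := integral_indicator_eq_residue_add hz h4 ε h6
    have h9 : μ[{ω' | α < inner ℝ β (X T ω' : V)}.indicator (fun ω' => y (X T ω')) | ℱ t] ω
        = ∫ ξ, {ξ : D | α < inner ℝ β (ξ : V)}.indicator y ξ ∂(p (T - t) (X t ω)) := h2
    rw [h9, h8, residue, h7]
    split_ifs <;> push_cast <;> rfl

end Leg

end MultiCurve

namespace MultiCurve

/-! ### Discounted prices in an affine multi-curve model -/

section Pricing

variable {Ω : Type*} [mΩ : MeasurableSpace Ω] {μ : Measure Ω}
  {ℱ : Filtration ℝ≥0 mΩ} {𝕋 : ℝ≥0} {m : ℕ} {M : Market Ω m}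

namespace Market

/-- The discounted bond price is the conditional expectation of the discounted unit payoff. -/
lemma bond_div_numeraire_ae_eq (hM : M.IsContractual μ 𝕋)
    (hB : M.IsNumeraireMartingaleCouple μ ℱ 𝕋) {t S : ℝ≥0} (htS : t ≤ S) (hS : S ≤ 𝕋) :
    (fun ω => M.bond t S ω / M.numeraire t ω)
      =ᵐ[μ] μ[fun ω => 1 / M.numeraire S ω | ℱ t] := by
  have h := (hB.bond_martingale S hS).condExp_ae_eq htS
  simp only [min_self, min_eq_left htS] at h
  refine h.symm.trans (condExp_congr_ae ?_)
  filter_upwards [hM.bond_maturity S hS] with ω hω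
  rw [hω]

lemma integrable_inv_numeraire (hM : M.IsContractual μ 𝕋)
    (hB : M.IsNumeraireMartingaleCouple μ ℱ 𝕋) {S : ℝ≥0} (hS : S ≤ 𝕋) :
    Integrable (fun ω => 1 / M.numeraire S ω) μ := by
  have h := (hB.bond_martingale S hS).integrable S
  simp only [min_self] at h
  refine h.congr ?_
  filter_upwards [hM.bond_maturity S hS] with ω hω
  rw [hω]

/-- The fair rate of a forward rate agreement, expressed through the discounted value of the
floating leg. -/
lemma one_add_fraRate_ae_eq (hM : M.IsContractual μ 𝕋)
    (hB : M.IsNumeraireMartingaleCouple μ ℱ 𝕋) {i : Fin m} {t S : ℝ≥0} (htS : t ≤ S)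
    (hS : S + M.tenor i ≤ 𝕋) :
    (fun ω => (1 + (M.tenor i : ℝ) * M.fraRate i t S ω) * M.bond t (S + M.tenor i) ω
        / M.numeraire t ω)
      =ᵐ[μ] μ[fun ω => (1 + (M.tenor i : ℝ) * M.fraRate i S S ω)
        / M.numeraire (S + M.tenor i) ω | ℱ t] := by
  set U := S + M.tenor i with hU
  set δ : ℝ := (M.tenor i : ℝ) with hδ
  have htU : t ≤ U := htS.trans le_self_add
  set Z : Ω → ℝ := fun ω => δ * M.fraRate i S S ω / M.numeraire U ω with hZ
  set W : Ω → ℝ := fun ω => 1 / M.numeraire U ω with hW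
  have hWi : Integrable W μ := integrable_inv_numeraire hM hB hS
  have hZi : Integrable Z μ := by
    have h := (hB.fra_martingale i S 0 hS).integrable U
    simp only [← hU, min_self] at h
    refine h.congr ?_
    filter_upwards [hM.fra_payoff i S 0 hS] with ω hω
    rw [hω, hZ, sub_zero]
  have hK : ∀ K : ℝ, ∀ᵐ ω ∂μ, M.fra i t S K ω / M.numeraire t ω
      = (μ[Z | ℱ t]) ω - δ * K * (μ[W | ℱ t]) ω := by
    intro K
    have h := (hB.fra_martingale i S K hS).condExp_ae_eq htU
    simp only [← hU, min_self, min_eq_left htU] at h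
    have h1 : (fun ω => M.fra i U S K ω / M.numeraire U ω) =ᵐ[μ] Z - (δ * K) • W := by
      filter_upwards [hM.fra_payoff i S K hS] with ω hω
      rw [hω]
      simp only [hZ, hW, Pi.sub_apply, Pi.smul_apply, smul_eq_mul]
      ring
    filter_upwards [h, condExp_congr_ae (m := ℱ t) h1, condExp_sub hZi (hWi.smul (δ * K)) (ℱ t),
      condExp_smul (δ * K) W (ℱ t)] with ω a1 a2 a3 a4
    rw [← a1, a2, a3, Pi.sub_apply, a4, Pi.smul_apply, smul_eq_mul]
  have hall : ∀ᵐ ω ∂μ, ∀ K : ℝ, M.fra i t S K ω / M.numeraire t ω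
      = (μ[Z | ℱ t]) ω - δ * K * (μ[W | ℱ t]) ω := by
    -- The fair rate is random, so the price formula must hold for all `K` off one null set: take
    -- rational `K` and extend by continuity.
    filter_upwards [ae_all_iff.2 fun q : ℚ => hK q, hM.fra_continuous i t S htS hS] with ω h1 h2
    have := Rat.denseRange_cast.equalizer (g := fun K => M.fra i t S K ω / M.numeraire t ω)
      (h := fun K : ℝ => (μ[Z | ℱ t]) ω - δ * K * (μ[W | ℱ t]) ω)
      (h2.div_const _) (by fun_prop) (funext h1)
    exact fun K => congr_fun this K
  have hsum : μ[fun ω => (1 + δ * M.fraRate i S S ω) / M.numeraire U ω | ℱ t]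
      =ᵐ[μ] μ[W | ℱ t] + μ[Z | ℱ t] := by
    refine EventuallyEq.trans (Eq.eventuallyEq ?_) (condExp_add hWi hZi (ℱ t))
    congr 1
    funext ω
    simp only [hZ, hW, Pi.add_apply]
    ring
  filter_upwards [hall, hsum, bond_div_numeraire_ae_eq hM hB htU hS, hM.fra_fair i t S htS hS]
    with ω h1 h2 h3 h4
  have h5 := h1 (M.fraRate i t S ω)
  rw [h4, zero_div] at h5
  rw [h2, Pi.add_apply, mul_div_assoc, h3]
  linear_combination h5

end Market

variable {V : Type*} [NormedAddCommGroup V] [InnerProductSpace ℝ V] {D : Set V}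
  {X : ℝ≥0 → Ω → D} {u : Fin (m + 1) → ℝ≥0 → V} {v : Fin (m + 1) → ℝ≥0 → ℝ}

lemma inv_numeraire_ae_eq (hmodel : IsAffineMultiCurveModel M μ 𝕋 X u v) {S : ℝ≥0} (hS : S ≤ 𝕋) :
    (fun ω => 1 / M.numeraire S ω)
      =ᵐ[μ] fun ω => Real.exp (v 0 S + inner ℝ (u 0 S) (X S ω : V)) := by
  filter_upwards [hmodel.numeraire_eq S hS] with ω hω
  rw [hω, one_div, ← Real.exp_neg]
  ring_nf

variable [MeasurableSpace V] {p : ℝ≥0 → Kernel D D} {φ : ℝ≥0 → V × V → ℂ}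
  {ψ : ℝ≥0 → V × V → V × V}

/-- The mean of `exp (c + ⟨a, X_s⟩)` for the process started at `ξ`. -/
noncomputable def expMean (p : ℝ≥0 → Kernel D D) (s : ℝ≥0) (c : ℝ) (a : V) (ξ : D) : ℝ :=
  ∫ η : D, Real.exp (c + inner ℝ a (η : V)) ∂(p s ξ)

/-- Although `φ` and `ψ` are complex, this exponential is the transition mean of a real exponential,
hence real. The affine formula applies at time `s` because finite moments up to `S` include those up
to `s`. -/
lemma exp_affine_eq_expMean (hX : IsAffineProcess μ ℱ 𝕋 D p X φ ψ) {s S : ℝ≥0} (hsS : s ≤ S)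
    (hS : S ≤ 𝕋) (c : ℝ) {a : V} (ha : ((a, 0) : V × V) ∈ expMomentSet μ X S) (ξ : D) :
    Complex.exp ((c : ℂ) + φ s (a, 0) + cpair (ψ s (a, 0)) (ξ : V))
      = ((expMean p s c a ξ : ℝ) : ℂ) := by
  have h := (hX.affine s (hsS.trans hS) (a, 0) (fun r hr => ha r (hr.trans hsS)) ξ).2
  rw [add_assoc, Complex.exp_add, ← h, expMean, ← integral_complex_ofReal, ← integral_const_mul]
  refine integral_congr_ae (ae_of_all _ fun η => ?_)
  simp only [cpair_ofReal]
  rw [← Complex.exp_add]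
  push_cast
  rfl

/-- The discounted value at `T_0` of the `j`-th leg as a function of the state at `T_0`. -/
noncomputable def legMean (p : ℝ≥0 → Kernel D D) (u : Fin (m + 1) → ℝ≥0 → V)
    (v : Fin (m + 1) → ℝ≥0 → ℝ) (i : Fin m) (n : ℕ) (Ts : ℕ → ℝ≥0) (j : ℕ) : D → ℝ :=
  expMean p (Ts (dateIndex n j) - Ts 0)
    (v 0 (Ts (dateIndex n j)) + legFun v i n j (Ts (dateIndex n j)))
    (legFun u i n j (Ts (dateIndex n j)) + u 0 (Ts (dateIndex n j)))

lemma exp_legConst_add_cpair (hX : IsAffineProcess μ ℱ 𝕋 D p X φ ψ)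
    (hmodel : IsAffineMultiCurveModel M μ 𝕋 X u v) (i : Fin m) (n : ℕ) (Ts : ℕ → ℝ≥0) (j : ℕ)
    (hS : Ts (dateIndex n j) ≤ 𝕋) (ξ : D) :
    Complex.exp (legConst φ u v i n Ts j + cpair (legDir ψ u i n Ts j) (ξ : V))
      = ((legMean p u v i n Ts j ξ : ℝ) : ℂ) := by
  refine exp_affine_eq_expMean hX tsub_le_self hS _ ?_ ξ
  unfold legFun
  split_ifs
  · exact hmodel.u_succ_mem i _ hS
  · rw [zero_add]
    exact hmodel.u_zero_mem _ hS

lemma sum_Icc_one_two_mul {A : Type*} [AddCommMonoid A] (f : ℕ → A) (n : ℕ) :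
    ∑ j ∈ Finset.Icc 1 (2 * n), f j
      = ∑ j ∈ Finset.Icc 1 n, f j + ∑ j ∈ Finset.Icc 1 n, f (n + j) := by
  have h := Finset.sum_Ico_consecutive f (show 1 ≤ n + 1 by omega)
    (show n + 1 ≤ 2 * n + 1 by omega)
  have h1 : ∑ j ∈ Finset.Icc 1 n, f (n + j) = ∑ j ∈ Finset.Ico (n + 1) (2 * n + 1), f j := by
    have := Finset.sum_Ico_add f 1 (n + 1) n
    rw [show 2 * n + 1 = n + 1 + n by ring, show n + 1 = 1 + n by ring,
      show 1 + n + n = n + 1 + n by ring, ← this]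
    rfl
  rw [h1]
  exact h.symm

variable [BorelSpace V] [IsProbabilityMeasure μ]

lemma condExp_exp_ae_eq_expMean (hX : IsAffineProcess μ ℱ 𝕋 D p X φ ψ) {T S : ℝ≥0} (hTS : T ≤ S)
    (hS : S ≤ 𝕋) (c : ℝ) {a : V} (ha : ((a, 0) : V × V) ∈ expMomentSet μ X S) :
    μ[fun ω => Real.exp (c + inner ℝ a (X S ω : V)) | ℱ T]
      =ᵐ[μ] fun ω => expMean p (S - T) c a (X T ω) := by
  have hm := measurable_inner_coe (D := D) a
  refine hX.condExp_comp hTS hS (f := fun η : D => Real.exp (c + inner ℝ a (η : V)))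
    (Measurable.stronglyMeasurable (by fun_prop)) ?_
  have h := (ha S le_rfl).norm.const_mul (Real.exp c)
  refine h.congr (ae_of_all _ fun ω => ?_)
  simp only [cpair_ofReal, Complex.norm_exp_ofReal]
  rw [Real.exp_add]

/-- The discounted bond price in an affine multi-curve model. -/
theorem bond_div_numeraire_ae_eq_expMean (hX : IsAffineProcess μ ℱ 𝕋 D p X φ ψ)
    (hM : M.IsContractual μ 𝕋) (hB : M.IsNumeraireMartingaleCouple μ ℱ 𝕋)
    (hmodel : IsAffineMultiCurveModel M μ 𝕋 X u v) {T S : ℝ≥0} (hTS : T ≤ S) (hS : S ≤ 𝕋) :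
    (fun ω => M.bond T S ω / M.numeraire T ω)
      =ᵐ[μ] fun ω => expMean p (S - T) (v 0 S) (u 0 S) (X T ω) :=
  (Market.bond_div_numeraire_ae_eq hM hB hTS hS).trans
    ((condExp_congr_ae (inv_numeraire_ae_eq hmodel hS)).trans
      (condExp_exp_ae_eq_expMean hX hTS hS _ (hmodel.u_zero_mem S hS)))

/-- The discounted price of a floating leg in an affine multi-curve model. -/
theorem bond_mul_spread_div_numeraire_ae_eq_expMean (hX : IsAffineProcess μ ℱ 𝕋 D p X φ ψ)
    (hM : M.IsContractual μ 𝕋) (hB : M.IsNumeraireMartingaleCouple μ ℱ 𝕋)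
    (hmodel : IsAffineMultiCurveModel M μ 𝕋 X u v) {i : Fin m} {T S : ℝ≥0} (hTS : T ≤ S)
    (hS : S + M.tenor i ≤ 𝕋) :
    (fun ω => M.bond T S ω * M.spread i T S ω / M.numeraire T ω)
      =ᵐ[μ] fun ω => expMean p (S - T) (v 0 S + v i.succ S) (u i.succ S + u 0 S) (X T ω) := by
  have hS' : S ≤ 𝕋 := le_self_add.trans hS
  have h1 := Market.one_add_fraRate_ae_eq hM hB hTS hS
  have h2 := Market.one_add_fraRate_ae_eq hM hB (le_refl S) hS
  have h3 : (fun ω => (1 + (M.tenor i : ℝ) * M.fraRate i S S ω) * M.bond S (S + M.tenor i) ω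
      / M.numeraire S ω) =ᵐ[μ] fun ω =>
        Real.exp ((v 0 S + v i.succ S) + inner ℝ (u i.succ S + u 0 S) (X S ω : V)) := by
    filter_upwards [inv_numeraire_ae_eq hmodel hS', hM.bond_maturity S hS',
      hmodel.spread_eq i S hS] with ω a1 a2 a3
    rw [Market.spread, a2, div_one] at a3
    rw [a3, div_eq_mul_one_div, a1, ← Real.exp_add, inner_add_left]
    ring_nf
  -- Tower property: conditioning at the fixing date `S` first replaces the payoff at `S + δ` by the
  -- exponential affine quantity of `h3`.
  have h4 := (condExp_condExp_of_le (f := fun ω => (1 + (M.tenor i : ℝ) * M.fraRate i S S ω)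
    / M.numeraire (S + M.tenor i) ω) (μ := μ) (ℱ.mono hTS) (ℱ.le S)).symm
  have h5 := h1.trans (h4.trans ((condExp_congr_ae (h2.symm.trans h3)).trans
    (condExp_exp_ae_eq_expMean hX hTS hS' _ (hmodel.u_succ_mem i S hS'))))
  filter_upwards [h5, bond_div_numeraire_ae_eq_expMean hX hM hB hmodel hTS hS'] with ω a1 a2
  -- The spread divides by the bond price; this is nonzero because the discounted price is a complex
  -- exponential.
  have h6 : M.bond T S ω ≠ 0 := by
    intro h0
    rw [h0, zero_div] at a2
    have h7 := exp_affine_eq_expMean hX (tsub_le_self (a := S) (b := T)) hS' (v 0 S)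
      (hmodel.u_zero_mem S hS') (X T ω)
    rw [← a2, Complex.ofReal_zero] at h7
    exact Complex.exp_ne_zero _ h7
  rw [← a1, Market.spread, mul_div_cancel₀ _ h6]

/-! ### The discounted swap value -/

/-- The discounted swap value is a linear combination of exponentials of the state. -/
theorem swapValue_div_numeraire_ae_eq (hX : IsAffineProcess μ ℱ 𝕋 D p X φ ψ)
    (hM : M.IsContractual μ 𝕋) (hB : M.IsNumeraireMartingaleCouple μ ℱ 𝕋)
    (hmodel : IsAffineMultiCurveModel M μ 𝕋 X u v) {i : Fin m} {n : ℕ} {Ts : ℕ → ℝ≥0} {K : ℝ}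
    (hle : ∀ j ≤ n, Ts 0 ≤ Ts j) (hpay : ∀ j, 1 ≤ j → j ≤ n → Ts j ≤ 𝕋)
    (hfix : ∀ j, 1 ≤ j → j ≤ n → Ts (j - 1) + M.tenor i ≤ 𝕋) :
    (fun ω => M.swapValue i n Ts K ω / M.numeraire (Ts 0) ω)
      =ᵐ[μ] fun ω => ∑ j ∈ Finset.Icc 1 (2 * n),
        weight (M.tenor i) K n j * legMean p u v i n Ts j (X (Ts 0) ω) := by
  have h1 : ∀ᵐ ω ∂μ, ∀ j ∈ Finset.Icc 1 n,
      M.bond (Ts 0) (Ts (j - 1)) ω * M.spread i (Ts 0) (Ts (j - 1)) ω / M.numeraire (Ts 0) ω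
        = legMean p u v i n Ts j (X (Ts 0) ω) := by
    refine (Finset.eventually_all _).2 fun j hj => ?_
    have hj := Finset.mem_Icc.1 hj
    have h := bond_mul_spread_div_numeraire_ae_eq_expMean hX hM hB hmodel
      (hle (j - 1) (by omega)) (hfix j hj.1 hj.2)
    filter_upwards [h] with ω hω
    rw [hω]
    simp only [legMean, dateIndex, legFun, if_pos hj.2]
  have h2 : ∀ᵐ ω ∂μ, ∀ j ∈ Finset.Icc 1 n,
      M.bond (Ts 0) (Ts j) ω / M.numeraire (Ts 0) ω
        = legMean p u v i n Ts (n + j) (X (Ts 0) ω) := by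
    refine (Finset.eventually_all _).2 fun j hj => ?_
    have hj := Finset.mem_Icc.1 hj
    have h := bond_div_numeraire_ae_eq_expMean hX hM hB hmodel
      (hle j hj.2) (hpay j hj.1 hj.2)
    filter_upwards [h] with ω hω
    have hn : ¬ n + j ≤ n := by omega
    rw [hω]
    simp only [legMean, dateIndex, legFun, if_neg hn, Nat.add_sub_cancel_left, zero_add, add_zero]
  filter_upwards [h1, h2] with ω a1 a2
  rw [sum_Icc_one_two_mul, Market.swapValue, Finset.sum_div, ← Finset.sum_add_distrib]
  refine Finset.sum_congr rfl fun j hj => ?_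
  have hj' := Finset.mem_Icc.1 hj
  have hn : ¬ n + j ≤ n := by omega
  rw [sub_div, mul_div_assoc (1 + _), a1 j hj, a2 j hj, weight, weight, if_pos hj'.2, if_neg hn]
  ring

end Pricing

end MultiCurve

namespace MultiCurve

/-! ### The payment schedule -/

section Dates

variable {n : ℕ} {Ts : ℕ → ℝ≥0} {δ : ℝ≥0}

lemma date_le_date (hTs : ∀ j, 1 ≤ j → j < n → Ts (j + 1) = Ts j + δ) {j k : ℕ} (hj : 1 ≤ j)
    (hjk : j ≤ k) (hk : k ≤ n) : Ts j ≤ Ts k := by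
  induction k, hjk using Nat.le_induction with
  | base => exact le_rfl
  | succ k hjk ih =>
    rw [hTs k (hj.trans hjk) (by omega)]
    exact (ih (by omega)).trans le_self_add

lemma start_le_date (h1 : Ts 0 ≤ Ts 1) (hTs : ∀ j, 1 ≤ j → j < n → Ts (j + 1) = Ts j + δ) {j : ℕ}
    (hj : j ≤ n) : Ts 0 ≤ Ts j := by
  rcases Nat.eq_zero_or_pos j with rfl | h
  · exact le_rfl
  · exact h1.trans (date_le_date hTs le_rfl h hj)

/-- The case `j = 1` rests on `hδ`, since the first period need not have length `δ`; for `j > 1` the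
left side is the next payment date. -/
lemma date_add_tenor_le {𝕋 : ℝ≥0} (hTs : ∀ j, 1 ≤ j → j < n → Ts (j + 1) = Ts j + δ)
    (hTn : Ts n ≤ 𝕋) (hδ : Ts 0 + δ ≤ 𝕋) {j : ℕ} (h1 : 1 ≤ j) (hj : j ≤ n) :
    Ts (j - 1) + δ ≤ 𝕋 := by
  rcases Nat.eq_or_lt_of_le h1 with rfl | h
  · simpa using hδ
  · rw [← hTs (j - 1) (by omega) (by omega), Nat.sub_add_cancel h1]
    exact (date_le_date hTs h1 hj le_rfl).trans hTn

lemma date_dateIndex_le {𝕋 : ℝ≥0} (hTs : ∀ j, 1 ≤ j → j < n → Ts (j + 1) = Ts j + δ)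
    (hTn : Ts n ≤ 𝕋) (hδ : Ts 0 + δ ≤ 𝕋) {j : ℕ} (hj : j ∈ Finset.Icc 1 (2 * n)) :
    Ts (dateIndex n j) ≤ 𝕋 := by
  have hj := Finset.mem_Icc.1 hj
  unfold dateIndex
  split_ifs with h
  · exact le_self_add.trans (date_add_tenor_le hTs hTn hδ hj.1 h)
  · exact (date_le_date hTs (by omega) (by omega) le_rfl).trans hTn

end Dates

end MultiCurve

/-! ### The swaption formula -/

theorem mainTheorem8
    {Ω : Type*} [mΩ : MeasurableSpace Ω] (μ : Measure Ω) [IsProbabilityMeasure μ]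
    (ℱ : Filtration ℝ≥0 mΩ)
    {V : Type*} [NormedAddCommGroup V] [InnerProductSpace ℝ V] [FiniteDimensional ℝ V]
    [MeasurableSpace V] [BorelSpace V]
    -- the affine process
    (𝕋 : ℝ≥0) (D : Set V) (p : ℝ≥0 → Kernel D D) (X : ℝ≥0 → Ω → D)
    (φ : ℝ≥0 → V × V → ℂ) (ψ : ℝ≥0 → V × V → V × V)
    (hX : IsAffineProcess μ ℱ 𝕋 D p X φ ψ)
    -- the market and the affine multi-curve model
    {m : ℕ} (M : Market Ω m) (hM : M.IsContractual μ 𝕋)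
    (hB : M.IsNumeraireMartingaleCouple μ ℱ 𝕋)
    (u : Fin (m + 1) → ℝ≥0 → V) (v : Fin (m + 1) → ℝ≥0 → ℝ)
    (hmodel : IsAffineMultiCurveModel M μ 𝕋 X u v)
    -- the swaption
    (i : Fin m) (n : ℕ) (hn : 1 ≤ n) (Ts : ℕ → ℝ≥0) (T : ℝ≥0) (hT : Ts 0 = T)
    (hT1 : T < Ts 1) (hTs : ∀ j, 1 ≤ j → j < n → Ts (j + 1) = Ts j + M.tenor i)
    (hTn : Ts n ≤ 𝕋) (hTδ : T + M.tenor i ≤ 𝕋)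
    (N K : ℝ) (hN : 0 ≤ N) (t : ℝ≥0) (htT : t ≤ T)
    -- the approximate exercise event and the damping parameter
    (β : V) (α : ℝ) (hα : ∀ᵐ ω ∂μ, inner ℝ β (X T ω : V) ≠ α)
    (hψ : ∀ j ∈ Finset.Icc 1 (2 * n), legDir ψ u i n Ts j ∈ expMomentSet μ X T)
    (ε : ℝ)
    (hε : ∀ j ∈ Finset.Icc 1 (2 * n),
      legDir ψ u i n Ts j + cmul (ε : ℂ) β ∈ expMomentSet μ X T) :
    -- the discounted payoff is integrable, and `Π̃` is a lower bound for the swaption price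
    Integrable (fun ω => M.swapValue i n Ts K ω / M.numeraire T ω) μ ∧
    (∀ᵐ ω ∂μ, M.swaptionLowerBound μ ℱ t i n Ts N K {ω' | α < inner ℝ β (X T ω' : V)} ω
      ≤ M.swaptionPrice μ ℱ t i n Ts N K ω) ∧
    -- the conditional transforms have jointly measurable versions along the contour
    (∀ j ∈ Finset.Icc 1 (2 * n), ∃ Φ : ℝ → Ω → ℂ,
      IsTransformVersion μ ℱ t (fun ω => (X T ω : V)) (legConst φ u v i n Ts j)
        (legDir ψ u i n Ts j) β ε Φ) ∧
    -- for all such versions, the Fourier integrals converge and the formula holds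
    ∀ Φ : ℕ → ℝ → Ω → ℂ,
      (∀ j ∈ Finset.Icc 1 (2 * n),
        IsTransformVersion μ ℱ t (fun ω => (X T ω : V)) (legConst φ u v i n Ts j)
          (legDir ψ u i n Ts j) β ε (Φ j)) →
      ∀ᵐ ω ∂μ, ∃ J : ℕ → ℝ,
        (∀ j ∈ Finset.Icc 1 (2 * n),
          HasImproperIntegral (fourierIntegrand α ε (fun x => Φ j x ω)) (J j)) ∧
        ((M.swaptionLowerBound μ ℱ t i n Ts N K {ω' | α < inner ℝ β (X T ω' : V)} ω : ℝ) : ℂ)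
          = (N : ℂ) * (M.numeraire t ω : ℂ) * ∑ j ∈ Finset.Icc 1 (2 * n),
              (weight (M.tenor i) K n j : ℂ) *
                (residue μ ℱ t (fun ω' => (X T ω' : V)) (legConst φ u v i n Ts j)
                    (legDir ψ u i n Ts j) ε ω
                  + 1 / (Real.pi : ℂ) * (J j : ℂ)) := by
  subst hT
  have hT𝕋 : Ts 0 ≤ 𝕋 := le_self_add.trans hTδ
  have hXM : IsMarkovProcess μ ℱ 𝕋 D p X := hX.toIsMarkovProcess
  have hXT := hXM.measurable hT𝕋
  have hdate : ∀ j ∈ Finset.Icc 1 (2 * n), Ts (dateIndex n j) ≤ 𝕋 :=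
    fun j hj => date_dateIndex_le hTs hTn hTδ hj
  set Y : ℕ → Ω → ℝ := fun j ω => legMean p u v i n Ts j (X (Ts 0) ω) with hY
  set w : ℕ → ℝ := weight (M.tenor i) K n with hw
  have hexp : ∀ j ∈ Finset.Icc 1 (2 * n), ∀ ξ : D,
      Complex.exp (legConst φ u v i n Ts j + cpair (legDir ψ u i n Ts j) (ξ : V))
        = ((legMean p u v i n Ts j ξ : ℝ) : ℂ) :=
    fun j hj ξ => exp_legConst_add_cpair hX hmodel i n Ts j (hdate j hj) ξ
  have hYi : ∀ j ∈ Finset.Icc 1 (2 * n), Integrable (Y j) μ := by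
    intro j hj
    -- Integrability of each leg is the moment condition on `ψ_j` at time `T`, scaled by `e^{c_j}`.
    have h := (hψ j hj (Ts 0) le_rfl).const_mul (Complex.exp (legConst φ u v i n Ts j))
    simp only [← Complex.exp_add, hexp j hj] at h
    simpa using h.re
  have hH : (fun ω => M.swapValue i n Ts K ω / M.numeraire (Ts 0) ω)
      =ᵐ[μ] fun ω => ∑ j ∈ Finset.Icc 1 (2 * n), w j * Y j ω :=
    swapValue_div_numeraire_ae_eq hX hM hB hmodel (fun j hj => start_le_date hT1.le hTs hj)
      (fun j h1 hj => (date_le_date hTs h1 hj le_rfl).trans hTn)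
      (fun j h1 hj => date_add_tenor_le hTs hTn hTδ h1 hj)
  have hHi : Integrable (fun ω => M.swapValue i n Ts K ω / M.numeraire (Ts 0) ω) μ :=
    (integrable_finsetSum _ fun j hj => (hYi j hj).const_mul (w j)).congr hH.symm
  set G : Set Ω := {ω' | α < inner ℝ β (X (Ts 0) ω' : V)} with hG
  have hGm : MeasurableSet G :=
    measurableSet_lt measurable_const ((measurable_inner_coe β).comp hXT)
  have hGind : ∀ ω, G.indicator (M.swapValue i n Ts K) ω / M.numeraire (Ts 0) ω
      = G.indicator (fun ω => M.swapValue i n Ts K ω / M.numeraire (Ts 0) ω) ω := by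
    intro ω
    by_cases h : ω ∈ G <;> simp [h]
  refine ⟨hHi, ?_, ?_, ?_⟩
  · have hpos : ∀ ω, max (M.swapValue i n Ts K ω) 0 / M.numeraire (Ts 0) ω
        = max (M.swapValue i n Ts K ω / M.numeraire (Ts 0) ω) 0 := fun ω => by
      rw [← max_div_div_right (hB.numeraire_pos _ hT𝕋 ω).le, zero_div]
    have hmono : μ[fun ω => G.indicator (M.swapValue i n Ts K) ω / M.numeraire (Ts 0) ω | ℱ t]
        ≤ᵐ[μ] μ[fun ω => max (M.swapValue i n Ts K ω) 0 / M.numeraire (Ts 0) ω | ℱ t] := by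
      simp only [hGind, hpos]
      -- Restricting to any event gives at most the positive part; the shape of `G` plays no role
      -- here.
      refine condExp_mono (hHi.indicator hGm) hHi.pos_part (ae_of_all _ fun ω => ?_)
      by_cases h : ω ∈ G <;> simp [h]
    filter_upwards [hmono] with ω hω
    exact mul_le_mul_of_nonneg_left (mul_le_mul_of_nonneg_left hω
      (hB.numeraire_pos _ (htT.trans hT𝕋) ω).le) hN
  · exact fun j hj => ⟨_, isTransformVersion_kernelTransform hXM htT hT𝕋 _ (hε j hj)⟩
  · intro Φ hΦ
    have hleg : ∀ᵐ ω ∂μ, ∀ j ∈ Finset.Icc 1 (2 * n), ∃ J : ℝ,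
        HasImproperIntegral (fourierIntegrand α ε (fun x => Φ j x ω)) J ∧
        ((μ[G.indicator (Y j) | ℱ t] ω : ℝ) : ℂ)
          = residue μ ℱ t (fun ω' => (X (Ts 0) ω' : V)) (legConst φ u v i n Ts j)
              (legDir ψ u i n Ts j) ε ω + 1 / (Real.pi : ℂ) * (J : ℂ) :=
      (Finset.eventually_all _).2 fun j hj => exists_hasImproperIntegral_leg hXM htT hT𝕋 hα
        (hψ j hj) (hε j hj) (hexp j hj) (hΦ j hj)
    have hsum : μ[fun ω => G.indicator (M.swapValue i n Ts K) ω / M.numeraire (Ts 0) ω | ℱ t]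
        =ᵐ[μ] fun ω => ∑ j ∈ Finset.Icc 1 (2 * n), w j * (μ[G.indicator (Y j) | ℱ t]) ω := by
      have h1 : (fun ω => G.indicator (M.swapValue i n Ts K) ω / M.numeraire (Ts 0) ω)
          =ᵐ[μ] ∑ j ∈ Finset.Icc 1 (2 * n), w j • G.indicator (Y j) := by
        filter_upwards [hH] with ω hω
        rw [hGind, Finset.sum_apply]
        by_cases h : ω ∈ G
        · simpa [h] using hω
        · simp [h]
      have h2 : ∀ᵐ ω ∂μ, ∀ j ∈ Finset.Icc 1 (2 * n),
          (μ[w j • G.indicator (Y j) | ℱ t]) ω = w j * (μ[G.indicator (Y j) | ℱ t]) ω :=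
        (Finset.eventually_all _).2 fun j _ => condExp_smul (w j) (G.indicator (Y j)) (ℱ t)
      filter_upwards [condExp_congr_ae (m := ℱ t) h1, h2, condExp_finsetSum
        (fun j hj => ((hYi j hj).indicator hGm).smul (w j)) (ℱ t)] with ω a1 a2 a3
      rw [a1, a3, Finset.sum_apply]
      exact Finset.sum_congr rfl a2
    filter_upwards [hleg, hsum] with ω h1 h2
    choose! J hJ using h1
    refine ⟨J, fun j hj => (hJ j hj).1, ?_⟩
    rw [Market.swaptionLowerBound, Market.claimPrice, h2, ← mul_assoc]
    push_cast
    congr 1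
    exact Finset.sum_congr rfl fun j hj => by rw [(hJ j hj).2]
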